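/- **Problems.** An ATSP instance $G=(V,d)$ is a complete directed graph on $n=|V|\ge 1$ vertices with real arc weights satisfying $d(u,u)=0$ and $d(u,v)\le d(u,w)+d(w,v)$ for all $u,v,w\in V$. A solution (tour) is a Hamiltonian cycle, its length is the total weight of its arcs, and $|OPT|$ is the minimum length. A No-Wait-Flowshop instance $I$ consists of $N\ge 1$ jobs and $m\ge 1$ machines with processing times $t_{jk}\in\mathbb{N}$ of job $j$ on machine $k$. With $$\delta(i,j)=\max_{1\le q\le m}\Big\{\sum_{k=1}^{q}t_{ik}-\sum_{k=1}^{q-1}t_{jk}\Big\},\qquad L(j)=\sum_{k=1}^m t_{jk},$$ the makespan of the no-wait schedule that processes the jobs in the order of the permutation $\sigma$ is $$C_{\max}(\sigma)=\sum_{k=1}^{N-1}\delta(\sigma_k,\sigma_{k+1})+L(\sigma_N).$$ A permutation $\sigma$ is an $\alpha$-approximate solution of $I$ ($\alpha\ge 1$) if $C_{\max}(\sigma)\le\alpha\min_{\sigma'}C_{\max}(\sigma')$. The size of $I$ is $\sum_{j,k}(1+\mathrm{len}(t_{jk}))$, where $\mathrm{len}$ is the binary length. **Model of computation.** Algorithms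 are programs of a random access machine whose cells hold natural numbers or exact real numbers, whose addresses are natural numbers, and whose elementary operations (assignments, additions, subtractions, comparisons, conditional branching) each cost one time unit; multiplication, division and rounding are not available, and the only constants are natural numbers. In particular the running times below do not depend on the magnitude of the arc weights. **Theorem.** 1. There are an absolute constant $C$, a polynomial bound $p(n,1/\varepsilon)=c\,(n+1/\varepsilon+1)^k$ and two algorithms such that, for every ATSP instance $G$ with $n$ vertices and every real $\varepsilon>0$, the following holds. Given $G$ and $\varepsilon$, the first algorithm constructs in time at most $p(n,1/\varepsilon)$ a No-Wait-Flowshop instance $I$ of size at most $p(n,1/\varepsilon)$. Given $G$, $\varepsilon$ and any permutation $\sigma$ of the jobs of $I$, the second algorithm constructs in time at most $p(n,1/\varepsilon)$ a tour $\tau$ of $G$ such that, for every $\alpha\ge 1$ for which $\sigma$ is an $\alpha$-approximate solution of $I$, the length of $\tau$ is at most $\alpha(1+C\varepsilon)\,|OPT|$. 2. Consequently, for every real $\alpha\ge 1$: if there is an algorithm that finds an $\alpha$-approximate solution of every No-Wait-Flowshop instance in time polynomial in the size of the instance, then there is an algorithm that, given an ATSP instance $G$ with $n$ vertices and any real $\varepsilon>0$,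 finds in time polynomial in $n$ and $1/\varepsilon$ a tour of $G$ of length at most $\alpha(1+\varepsilon)\,|OPT|$. -/

import Mathlib

namespace FlowshopATSP

/-! ### The asymmetric traveling salesman problem -/

/-- An instance of ATSP: a complete directed graph on the vertex set `Fin n` with real arc weights
that satisfy the semimetric properties. -/
structure ATSP where
  n : ℕ
  n_pos : 0 < n
  d : Fin n → Fin n → ℝ
  d_self : ∀ u, d u u = 0
  triangle : ∀ u w v, d u v ≤ d u w + d w v

/-- The length of the Hamiltonian cycle that visits the vertices in the cyclic order
`τ 0, τ 1, …, τ (n - 1), τ 0`. -/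
def ATSP.tourLength (G : ATSP) (τ : Equiv.Perm (Fin G.n)) : ℝ :=
  ∑ k : Fin G.n, G.d (τ k) (τ (finRotate G.n k))

/-- The value of an optimal tour. -/
noncomputable def ATSP.opt (G : ATSP) : ℝ :=
  Finset.univ.inf' Finset.univ_nonempty G.tourLength

/-! ### The no-wait flowshop problem -/

/-- An instance of no-wait flowshop: `time j k` is the processing time of job `j` on machine `k`. -/
structure NWFS where
  jobs : ℕ
  machines : ℕ
  jobs_pos : 0 < jobs
  machines_pos : 0 < machines
  time : Fin jobs → Fin machines → ℕ

/-- The total processing time of a job. -/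
def NWFS.jobLength (I : NWFS) (j : Fin I.jobs) : ℤ := ∑ k, (I.time j k : ℤ)

/-- The minimum delay between the start of job `i` and the start of job `j` when `j` is processed
directly after `i`:
`δ(i,j) = max over q of (∑ k ≤ q, time i k) - (∑ k < q, time j k)`. -/
def NWFS.delay (I : NWFS) (i j : Fin I.jobs) : ℤ :=
  Finset.univ.sup' (⟨⟨0, I.machines_pos⟩, Finset.mem_univ _⟩ :
      (Finset.univ : Finset (Fin I.machines)).Nonempty)
    (fun q => ∑ k ∈ Finset.Iic q, (I.time i k : ℤ) - ∑ k ∈ Finset.Iio q, (I.time j k : ℤ))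

/-- The makespan of the no-wait permutation schedule that processes the jobs in the order
`σ 0, σ 1, …`: the sum of the delays between consecutive jobs plus the length of the last job. -/
def NWFS.makespan (I : NWFS) (σ : Equiv.Perm (Fin I.jobs)) : ℤ :=
  ∑ k : Fin I.jobs,
    if h : (k : ℕ) + 1 < I.jobs then I.delay (σ k) (σ ⟨k + 1, h⟩) else I.jobLength (σ k)

/-- The minimum makespan. -/
def NWFS.opt (I : NWFS) : ℤ := Finset.univ.inf' Finset.univ_nonempty I.makespan

/-- `σ` is an `α`-approximate solution. -/
def NWFS.IsApprox (I : NWFS) (α : ℝ) (σ : Equiv.Perm (Fin I.jobs)) : Prop :=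
  (I.makespan σ : ℝ) ≤ α * (I.opt : ℝ)

/-- The size of an instance: one unit per operation plus the binary lengths of all processing
times. -/
def NWFS.size (I : NWFS) : ℕ := ∑ j, ∑ k, (Nat.size (I.time j k) + 1)

/-! ### The machine model

A random access machine with two kinds of memory cells, for natural numbers and for real numbers.
Memory is organised in arrays with a fixed name and two run-time indices, which are natural numbers.
The only arithmetic operations are addition, subtraction and comparison, and the only constants are
natural numbers. -/

structure State where
  nat : ℕ → ℕ → ℕ → ℕ
  real : ℕ → ℕ → ℕ → ℝ

/-- Expressions for natural numbers; subtraction is truncated at zero. -/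
inductive NExp where
  | const (c : ℕ)
  | read (x : ℕ) (i j : NExp)
  | add (a b : NExp)
  | sub (a b : NExp)

def NExp.eval (s : State) : NExp → ℕ
  | .const c => c
  | .read x i j => s.nat x (i.eval s) (j.eval s)
  | .add a b => a.eval s + b.eval s
  | .sub a b => a.eval s - b.eval s

/-- Expressions for real numbers. -/
inductive RExp where
  | const (c : ℕ)
  | read (x : ℕ) (i j : NExp)
  | add (a b : RExp)
  | sub (a b : RExp)

noncomputable def RExp.eval (s : State) : RExp → ℝ
  | .const c => (c : ℝ)
  | .read x i j => s.real x (i.eval s) (j.eval s)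
  | .add a b => a.eval s + b.eval s
  | .sub a b => a.eval s - b.eval s

/-- Tests. -/
inductive Test where
  | natLe (a b : NExp)
  | realLe (a b : RExp)
  | not (b : Test)
  | and (b c : Test)

def Test.eval (s : State) : Test → Prop
  | .natLe a b => a.eval s ≤ b.eval s
  | .realLe a b => a.eval s ≤ b.eval s
  | .not b => ¬ b.eval s
  | .and b c => b.eval s ∧ c.eval s

/-- Programs. -/
inductive Program where
  | skip
  | setNat (x : ℕ) (i j : NExp) (e : NExp)
  | setReal (x : ℕ) (i j : NExp) (e : RExp)
  | seq (p q : Program)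
  | ite (b : Test) (p q : Program)
  | loop (b : Test) (p : Program)

def State.setNat (s : State) (x i j v : ℕ) : State where
  nat := fun x' i' j' => if x' = x ∧ i' = i ∧ j' = j then v else s.nat x' i' j'
  real := s.real

noncomputable def State.setReal (s : State) (x i j : ℕ) (v : ℝ) : State where
  nat := s.nat
  real := fun x' i' j' => if x' = x ∧ i' = i ∧ j' = j then v else s.real x' i' j'

/-- `Exec p s s' T`: started in memory state `s`, the program `p` halts in memory state `s'` after
`T` steps. Every executed assignment (or `skip`) and every evaluated test counts as one step; the
expressions that occur have a size that is fixed by the program, so that this is, up to a constant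
factor, the number of elementary operations. -/
inductive Exec : Program → State → State → ℕ → Prop where
  | skip (s : State) : Exec .skip s s 1
  | setNat (s : State) (x : ℕ) (i j e : NExp) :
      Exec (.setNat x i j e) s (s.setNat x (i.eval s) (j.eval s) (e.eval s)) 1
  | setReal (s : State) (x : ℕ) (i j : NExp) (e : RExp) :
      Exec (.setReal x i j e) s (s.setReal x (i.eval s) (j.eval s) (e.eval s)) 1
  | seq {p q : Program} {s s' s'' : State} {T T' : ℕ} :
      Exec p s s' T → Exec q s' s'' T' → Exec (.seq p q) s s'' (T + T')
  | iteTrue {b : Test} {p q : Program} {s s' : State} {T : ℕ} :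
      b.eval s → Exec p s s' T → Exec (.ite b p q) s s' (T + 1)
  | iteFalse {b : Test} {p q : Program} {s s' : State} {T : ℕ} :
      ¬ b.eval s → Exec q s s' T → Exec (.ite b p q) s s' (T + 1)
  | loopDone {b : Test} {p : Program} {s : State} :
      ¬ b.eval s → Exec (.loop b p) s s 1
  | loopStep {b : Test} {p : Program} {s s' s'' : State} {T T' : ℕ} :
      b.eval s → Exec p s s' T → Exec (.loop b p) s' s'' T' →
      Exec (.loop b p) s s'' (T + T' + 1)

/-- Started in `s`, the program halts within `B` steps in a state that satisfies `post`. -/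
def Program.HaltsWithin (p : Program) (s : State) (B : ℝ) (post : State → Prop) : Prop :=
  ∃ s' T, Exec p s s' T ∧ (T : ℝ) ≤ B ∧ post s'

/-! ### Input and output conventions

Natural-number arrays: `0` the number of vertices, `1` the number of jobs, `2` the number of
machines, `3` the processing times, `4` a job order, `5` a vertex order.
Real arrays: `0` the arc weights, `1` the number `ε`. All other cells of an input are zero. -/

/-- The input that consists of `G` and `ε`. -/
noncomputable def ATSP.input (G : ATSP) (ε : ℝ) : State where
  nat := fun x i j => if x = 0 ∧ i = 0 ∧ j = 0 then G.n else 0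
  real := fun x i j =>
    if h : x = 0 ∧ i < G.n ∧ j < G.n then G.d ⟨i, h.2.1⟩ ⟨j, h.2.2⟩
    else if x = 1 ∧ i = 0 ∧ j = 0 then ε else 0

/-- The input that consists of `G`, `ε` and a job order. -/
noncomputable def ATSP.inputWithSchedule (G : ATSP) (ε : ℝ) {N : ℕ} (σ : Equiv.Perm (Fin N)) :
    State where
  nat := fun x i j =>
    if h : x = 4 ∧ i < N ∧ j = 0 then (σ ⟨i, h.2.1⟩ : ℕ) else (G.input ε).nat x i j
  real := (G.input ε).real

/-- The input that consists of a flowshop instance. -/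
def NWFS.input (I : NWFS) : State where
  nat := fun x i j =>
    if x = 1 ∧ i = 0 ∧ j = 0 then I.jobs
    else if x = 2 ∧ i = 0 ∧ j = 0 then I.machines
    else if h : x = 3 ∧ i < I.jobs ∧ j < I.machines then I.time ⟨i, h.2.1⟩ ⟨j, h.2.2⟩
    else 0
  real := fun _ _ _ => 0

/-- The memory contains the flowshop instance `I`. -/
def State.HoldsInstance (s : State) (I : NWFS) : Prop :=
  s.nat 1 0 0 = I.jobs ∧ s.nat 2 0 0 = I.machines ∧
    ∀ (j : Fin I.jobs) (k : Fin I.machines), s.nat 3 j k = I.time j k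

/-- The memory contains the job order `σ`. -/
def State.HoldsSchedule (s : State) {N : ℕ} (σ : Equiv.Perm (Fin N)) : Prop :=
  ∀ k : Fin N, s.nat 4 k 0 = (σ k : ℕ)

/-- The memory contains the vertex order `τ`. -/
def State.HoldsTour (s : State) {n : ℕ} (τ : Equiv.Perm (Fin n)) : Prop :=
  ∀ k : Fin n, s.nat 5 k 0 = (τ k : ℕ)

/-! ### Approximation algorithms -/

/-- A polynomial bound in `n` and `1 / ε`. -/
noncomputable def polyBound (c k n : ℕ) (ε : ℝ) : ℝ := c * ((n : ℝ) + 1 / ε + 1) ^ k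

/-- `A` is a polynomial-time `α`-approximation algorithm for no-wait flowshop. -/
def IsApproxAlgNWFS (α : ℝ) (A : Program) : Prop :=
  ∃ c k : ℕ, ∀ I : NWFS,
    A.HaltsWithin I.input (c * (I.size : ℝ) ^ k)
      (fun s => ∃ σ : Equiv.Perm (Fin I.jobs), s.HoldsSchedule σ ∧ I.IsApprox α σ)

/-- `B`, given `G` and `ε > 0`, finds an `α (1 + ε)`-approximate tour of `G` in time polynomial
in `n` and `1 / ε`. -/
def IsApproxSchemeATSP (α : ℝ) (B : Program) : Prop :=
  ∃ c k : ℕ, ∀ (G : ATSP) (ε : ℝ), 0 < ε →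
    B.HaltsWithin (G.input ε) (polyBound c k G.n ε)
      (fun s => ∃ τ : Equiv.Perm (Fin G.n), s.HoldsTour τ ∧
        G.tourLength τ ≤ α * (1 + ε) * G.opt)

end FlowshopATSP


/-!
Shifting the arc weights by the potential `v ↦ d 0 v` changes no tour length and makes all arcs
that leave the root `0` free, so every tour is at least as long as the largest arc. Scaling by that
length and rounding up gives integral weights `w ≤ P` with `P ≈ n / ε`, which determine the length
of a tour up to a factor `1 + ε`.

The flowshop instance consists of `P * P` copies of the weighted graph. A job `(u, c)` has
coordinates `w u v` for all vertices `v`, and the coordinate `w u 0` at two positions that encode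
the copy `c`. Each coordinate `F` is spread over `2 * P` machines, on which the head start that the
job accumulates goes up from `0` to `F`, waits, and goes down again. The delay between two jobs is
the maximal excess of the coordinates of the first over those of the second, up to `2`: this is
`w u v` within a copy by the triangle inequality, and `w u 0` between different copies. Hence the
makespan is `P * P` times a tour length up to lower order terms, and at least the sum, over all
copies, of the lengths of the tours in which the schedule visits the copies. The best of these
tours is the answer.

For the consequence, a given flowshop program becomes a subroutine after renaming its arrays, so
that it sees nothing but the constructed instance and zeros.
-/

namespace FlowshopATSP

section Tours

variable {n : ℕ}

/-- The total weight of the cyclic vertex order `τ 0, τ 1, …, τ (n - 1), τ 0`, for weights in any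
additive monoid: used for real and for integral weights. -/
def tourWeight {M : Type*} [AddCommMonoid M] (w : Fin n → Fin n → M) (τ : Equiv.Perm (Fin n)) : M :=
  ∑ i, w (τ i) (τ (finRotate n i))

theorem tourWeight_add_potential {M : Type*} [AddCommGroup M] (w : Fin n → Fin n → M)
    (p : Fin n → M) (τ : Equiv.Perm (Fin n)) :
    tourWeight (fun u v => w u v + p u - p v) τ = tourWeight w τ := by
  have sum_source : ∑ i, p (τ i) = ∑ u, p u := Equiv.sum_comp τ p
  have sum_target : ∑ i, p (τ (finRotate n i)) = ∑ u, p u :=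
    Equiv.sum_comp ((finRotate n).trans τ) p
  simp only [tourWeight, Finset.sum_sub_distrib, Finset.sum_add_distrib, sum_source, sum_target,
    add_sub_cancel_right]

variable [NeZero n]

theorem tourWeight_addRight_trans {M : Type*} [AddCommMonoid M] (w : Fin n → Fin n → M)
    (τ : Equiv.Perm (Fin n)) (k : Fin n) :
    tourWeight w ((Equiv.addRight k).trans τ) = tourWeight w τ := by
  simp only [tourWeight, finRotate_apply, Equiv.trans_apply, Equiv.coe_addRight,
    add_right_comm _ 1 k]
  exact Equiv.sum_comp (Equiv.addRight k) fun i => w (τ i) (τ (i + 1))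

theorem exists_tourWeight_eq_of_apply_zero {M : Type*} [AddCommMonoid M] (w : Fin n → Fin n → M)
    (τ : Equiv.Perm (Fin n)) (r : Fin n) :
    ∃ ρ : Equiv.Perm (Fin n), ρ 0 = r ∧ tourWeight w ρ = tourWeight w τ :=
  ⟨(Equiv.addRight (τ.symm r)).trans τ, by simp, tourWeight_addRight_trans w τ _⟩

section Triangle

variable {M : Type*} [AddCommGroup M] [PartialOrder M] [IsOrderedAddMonoid M]
  {w : Fin n → Fin n → M}

theorem le_sum_range_add_of_triangle (triangle : ∀ u v x, w u x ≤ w u v + w v x)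
    (τ : Equiv.Perm (Fin n)) (i r : Fin n) (t : ℕ) :
    w (τ i) r ≤ ∑ s ∈ Finset.range t, w (τ (i + Fin.ofNat n s)) (τ (i + Fin.ofNat n s + 1)) +
      w (τ (i + Fin.ofNat n t)) r := by
  induction t with
  | zero => simp
  | succ t ih =>
    have shift : i + Fin.ofNat n (t + 1) = i + Fin.ofNat n t + 1 := by
      rw [add_assoc]
      congr 1
      ext
      simp [Fin.val_add]
    rw [Finset.sum_range_succ, shift, add_assoc]
    exact ih.trans (add_le_add_right (triangle _ _ _) _)

theorem le_tourWeight_of_triangle (triangle : ∀ u v x, w u x ≤ w u v + w v x)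
    (self : ∀ u, w u u = 0) (nonneg : ∀ u v, 0 ≤ w u v) (τ : Equiv.Perm (Fin n)) (u r : Fin n) :
    w u r ≤ tourWeight w τ := by
  obtain ⟨i, rfl⟩ := τ.surjective u
  have path := le_sum_range_add_of_triangle triangle τ i r (τ.symm r - i).val
  have endpoint : i + Fin.ofNat n (τ.symm r - i).val = τ.symm r := by simp
  have cycle : ∑ s ∈ Finset.range n, w (τ (i + Fin.ofNat n s)) (τ (i + Fin.ofNat n s + 1)) =
      tourWeight w τ := by
    simp only [tourWeight, finRotate_apply]
    rw [← Fin.sum_univ_eq_sum_range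
      (fun s => w (τ (i + Fin.ofNat n s)) (τ (i + Fin.ofNat n s + 1)))]
    simp only [Fin.ofNat_eq_cast, Fin.cast_val_eq_self]
    exact Equiv.sum_comp (Equiv.addLeft i) fun j => w (τ j) (τ (j + 1))
  rw [endpoint, Equiv.apply_symm_apply, self, add_zero] at path
  rw [← cycle]
  exact path.trans (Finset.sum_le_sum_of_subset_of_nonneg
    (Finset.range_subset_range.2 (Fin.is_lt _).le) fun _ _ _ => nonneg _ _)

end Triangle

end Tours

section Makespan

variable {I : NWFS} (σ : Equiv.Perm (Fin I.jobs))

theorem NWFS.makespan_le {f : Fin I.jobs → ℤ} {L : ℤ} (nonneg : ∀ k, 0 ≤ f k)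
    (delay_le : ∀ (k : Fin I.jobs) (h : (k : ℕ) + 1 < I.jobs),
      I.delay (σ k) (σ ⟨k + 1, h⟩) ≤ f k)
    (jobLength_le : ∀ j, I.jobLength j ≤ L) : I.makespan σ ≤ ∑ k, f k + L := by
  have jobs_pos := I.jobs_pos
  let last : Fin I.jobs := ⟨I.jobs - 1, by omega⟩
  have sum_last : ∑ k, (if k = last then L else 0) = L := by simp
  rw [NWFS.makespan, ← sum_last, ← Finset.sum_add_distrib]
  refine Finset.sum_le_sum fun k _ => ?_
  split_ifs with h h' h'
  · subst h'
    simp only [last] at h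
    omega
  · simpa using delay_le k h
  · linarith [nonneg k, jobLength_le (σ k)]
  · exact absurd (Fin.ext (by simp only [last]; omega)) h'

theorem NWFS.le_makespan {f : Fin I.jobs → ℤ}
    (le_delay : ∀ (k : Fin I.jobs) (h : (k : ℕ) + 1 < I.jobs),
      f k ≤ I.delay (σ k) (σ ⟨k + 1, h⟩))
    (le_jobLength : ∀ k, f k ≤ I.jobLength (σ k)) : ∑ k, f k ≤ I.makespan σ := by
  refine Finset.sum_le_sum fun k _ => ?_
  split_ifs with h
  exacts [le_delay k h, le_jobLength k]

end Makespan

section Profiles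

/-- A walk on the natural numbers that starts at `0` and whose steps are `-1`, `0` or `1`: the head
start that a job with processing times at most `2` accumulates over unit processing times. -/
structure IsLazyWalk (f : ℕ → ℕ) : Prop where
  zero : f 0 = 0
  succ_le (k : ℕ) : f (k + 1) ≤ f k + 1
  le_succ (k : ℕ) : f k ≤ f (k + 1) + 1

theorem IsLazyWalk.sum_range {f : ℕ → ℕ} (hf : IsLazyWalk f) (m : ℕ) :
    ∑ k ∈ Finset.range m, (1 + f (k + 1) - f k) = m + f m := by
  induction m with
  | zero => simp [hf.zero]
  | succ m ih =>
    have := hf.le_succ m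
    rw [Finset.sum_range_succ, ih]
    omega

variable {N M : ℕ}

/-- The flowshop instance in which job `j` has completed `q + f j q` units of processing before
machine `q`. -/
abbrev NWFS.ofProfiles (hN : 0 < N) (hM : 0 < M) (f : Fin N → ℕ → ℕ) : NWFS where
  jobs := N
  machines := M
  jobs_pos := hN
  machines_pos := hM
  time j k := 1 + f j (k + 1) - f j k

variable {hN : 0 < N} {hM : 0 < M} {f : Fin N → ℕ → ℕ}

theorem sum_Iic_fin {R : Type*} [AddCommMonoid R] (g : ℕ → R) (q : Fin M) :
    ∑ k ∈ Finset.Iic q, g k = ∑ k ∈ Finset.range (q + 1), g k := by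
  rw [Nat.range_succ_eq_Iic, ← Fin.map_valEmbedding_Iic, Finset.sum_map]
  rfl

theorem sum_Iio_fin {R : Type*} [AddCommMonoid R] (g : ℕ → R) (q : Fin M) :
    ∑ k ∈ Finset.Iio q, g k = ∑ k ∈ Finset.range q, g k := by
  rw [← Nat.Iio_eq_range, ← Fin.map_valEmbedding_Iio, Finset.sum_map]
  rfl

theorem delay_term_ofProfiles (hf : ∀ j, IsLazyWalk (f j)) (i j : Fin N) (q : Fin M) :
    ∑ k ∈ Finset.Iic q, (((NWFS.ofProfiles hN hM f).time i k : ℕ) : ℤ) -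
      ∑ k ∈ Finset.Iio q, (((NWFS.ofProfiles hN hM f).time j k : ℕ) : ℤ) =
    1 + f i (q + 1) - f j q := by
  rw [sum_Iic_fin fun k => ((1 + f i (k + 1) - f i k : ℕ) : ℤ),
    sum_Iio_fin fun k => ((1 + f j (k + 1) - f j k : ℕ) : ℤ), ← Nat.cast_sum, ← Nat.cast_sum,
    (hf i).sum_range, (hf j).sum_range]
  push_cast
  ring

theorem delay_ofProfiles_le (hf : ∀ j, IsLazyWalk (f j)) {i j : Fin N} {B : ℕ}
    (h : ∀ q, f i q ≤ f j q + B) : (NWFS.ofProfiles hN hM f).delay i j ≤ B + 2 := by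
  refine Finset.sup'_le _ _ fun q _ => ?_
  rw [delay_term_ofProfiles hf]
  have := h q
  have := (hf i).succ_le q
  omega

theorem le_delay_ofProfiles (hf : ∀ j, IsLazyWalk (f j)) (i j : Fin N) {q : ℕ} (hq : q < M) :
    (1 + f i (q + 1) - f j q : ℤ) ≤ (NWFS.ofProfiles hN hM f).delay i j := by
  refine le_trans ?_ (Finset.le_sup' _ (Finset.mem_univ ⟨q, hq⟩))
  rw [delay_term_ofProfiles hf]

theorem jobLength_ofProfiles (hf : ∀ j, IsLazyWalk (f j)) (j : Fin N) :
    (NWFS.ofProfiles hN hM f).jobLength j = M + f j M := by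
  rw [NWFS.jobLength, Fin.sum_univ_eq_sum_range fun k => ((1 + f j (k + 1) - f j k : ℕ) : ℤ),
    ← Nat.cast_sum, (hf j).sum_range, Nat.cast_add]

theorem size_ofProfiles_le (hf : ∀ j, IsLazyWalk (f j)) :
    (NWFS.ofProfiles hN hM f).size ≤ N * M * 3 := by
  have digits_le : ∀ t ≤ 2, Nat.size t + 1 ≤ 3 := by decide
  calc (NWFS.ofProfiles hN hM f).size
      ≤ ∑ _j : Fin N, ∑ _k : Fin M, 3 := by
        refine Finset.sum_le_sum fun j _ => Finset.sum_le_sum fun k _ => digits_le _ ?_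
        have := (hf j).succ_le k
        change 1 + f j (k + 1) - f j k ≤ 2
        omega
    _ = N * M * 3 := by simp [mul_assoc]

end Profiles

section Waves

variable {P F F' B : ℕ}

/-- The trapezoid on `0, …, 2 * P` that rises with slope `1` to the height `F ≤ P`, and descends
with slope `-1` from `P` on. -/
def wave (P F s : ℕ) : ℕ := min F s - min F (s - P)

/-- The trapezoids of the heights `F 0, F 1, …`, one after the other. -/
def waveTrain (P : ℕ) (F : ℕ → ℕ) (k : ℕ) : ℕ := wave P (F (k / (2 * P))) (k % (2 * P))

theorem wave_le_add (h : F ≤ F' + B) (s : ℕ) : wave P F s ≤ wave P F' s + B := by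
  unfold wave
  omega

theorem waveTrain_mul_add (F : ℕ → ℕ) (q : ℕ) {s : ℕ} (hs : s < 2 * P) :
    waveTrain P F (q * (2 * P) + s) = wave P (F q) s := by
  have hP : 0 < 2 * P := by omega
  obtain ⟨div_eq, mod_eq⟩ := (Nat.div_mod_unique (a := q * (2 * P) + s) (c := s) (d := q) hP).2
    ⟨by ring, hs⟩
  rw [waveTrain, div_eq, mod_eq]

theorem waveTrain_succ {F : ℕ → ℕ} (hF : ∀ q, F q ≤ P) (hP : 0 < P) (k : ℕ) :
    waveTrain P F (k + 1) = wave P (F (k / (2 * P))) (k % (2 * P) + 1) := by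
  have decomp := Nat.div_add_mod' k (2 * P)
  have lt := Nat.mod_lt k (show 0 < 2 * P by omega)
  rcases (Nat.succ_le_of_lt lt).lt_or_eq with h | h
  · rw [← waveTrain_mul_add F _ h, Nat.succ_eq_add_one, ← add_assoc, decomp]
  · have next : k + 1 = (k / (2 * P) + 1) * (2 * P) + 0 := by rw [add_mul]; omega
    have := hF (k / (2 * P))
    rw [next, waveTrain_mul_add F _ (by omega), ← Nat.succ_eq_add_one (k % _), h]
    unfold wave
    omega

theorem isLazyWalk_waveTrain {F : ℕ → ℕ} (hF : ∀ q, F q ≤ P) (hP : 0 < P) :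
    IsLazyWalk (waveTrain P F) where
  zero := by simp [waveTrain, wave]
  succ_le k := by
    rw [waveTrain_succ hF hP, waveTrain]
    unfold wave
    omega
  le_succ k := by
    rw [waveTrain_succ hF hP, waveTrain]
    unfold wave
    omega

theorem waveTrain_le_add {F F' : ℕ → ℕ} (h : ∀ q, F q ≤ F' q + B) (k : ℕ) :
    waveTrain P F k ≤ waveTrain P F' k + B :=
  wave_le_add (h _) _

theorem waveTrain_mul (F : ℕ → ℕ) (hP : 0 < P) (q : ℕ) : waveTrain P F (q * (2 * P)) = 0 := by
  simpa [wave] using waveTrain_mul_add F q (show 0 < 2 * P by omega)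

end Waves

section WaveTrains

variable {N m P B : ℕ} [NeZero N] [NeZero m] [NeZero P]

/-- The flowshop instance in which job `j` has the coordinates `F j 0, …, F j (m - 1)`, each spread
over `2 * P` machines. -/
abbrev NWFS.ofCoords (m P : ℕ) [NeZero m] [NeZero P] (F : Fin N → ℕ → ℕ) : NWFS :=
  NWFS.ofProfiles (Nat.pos_of_neZero N)
    (Nat.mul_pos (Nat.pos_of_neZero m) (Nat.mul_pos two_pos (Nat.pos_of_neZero P)))
    fun j => waveTrain P (F j)

variable {F : Fin N → ℕ → ℕ}

theorem delay_ofCoords_le (hF : ∀ j q, F j q ≤ P) {i j : Fin N} (h : ∀ q, F i q ≤ F j q + B) :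
    (NWFS.ofCoords m P F).delay i j ≤ B + 2 :=
  delay_ofProfiles_le (fun j => isLazyWalk_waveTrain (hF j) (Nat.pos_of_neZero P))
    (waveTrain_le_add h)

theorem le_delay_ofCoords (hF : ∀ j q, F j q ≤ P) (i j : Fin N) {q : ℕ} (hq : q < m) :
    (F i q - F j q : ℤ) ≤ (NWFS.ofCoords m P F).delay i j := by
  have hP := Nat.pos_of_neZero P
  have peak_lt : q * (2 * P) + (P - 1) < m * (2 * P) := by
    calc q * (2 * P) + (P - 1) < (q + 1) * (2 * P) := by rw [add_mul]; omega
      _ ≤ m * (2 * P) := Nat.mul_le_mul_right _ hq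
  refine le_trans ?_ (le_delay_ofProfiles
    (fun j => isLazyWalk_waveTrain (hF j) hP) i j peak_lt)
  rw [add_assoc (q * (2 * P)), Nat.sub_add_cancel hP, waveTrain_mul_add _ _ (by omega),
    waveTrain_mul_add _ _ (by omega)]
  have := hF i q
  unfold wave
  omega

theorem jobLength_ofCoords (hF : ∀ j q, F j q ≤ P) (j : Fin N) :
    (NWFS.ofCoords m P F).jobLength j = (m * (2 * P) : ℕ) := by
  rw [jobLength_ofProfiles fun j => isLazyWalk_waveTrain (hF j) (Nat.pos_of_neZero P),
    waveTrain_mul _ (Nat.pos_of_neZero P), Nat.cast_zero, add_zero]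

theorem size_ofCoords_le (hF : ∀ j q, F j q ≤ P) :
    (NWFS.ofCoords m P F).size ≤ N * (m * (2 * P)) * 3 :=
  size_ofProfiles_le fun j => isLazyWalk_waveTrain (hF j) (Nat.pos_of_neZero P)

end WaveTrains

section Copies

variable {n : ℕ} [NeZero n]

/-- `w` is an integral semimetric with values at most `P` for which all distances from the root `0`
vanish. -/
structure IsRootedSemimetric (P : ℕ) (w : Fin n → Fin n → ℕ) : Prop where
  self (u : Fin n) : w u u = 0
  root (v : Fin n) : w 0 v = 0
  triangle (u v x : Fin n) : w u x ≤ w u v + w v x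
  le (u v : Fin n) : w u v ≤ P

variable {P : ℕ} {w : Fin n → Fin n → ℕ}

theorem IsRootedSemimetric.le_root (hw : IsRootedSemimetric P w) (u v : Fin n) :
    w u v ≤ w u 0 := by
  simpa [hw.root] using hw.triangle u 0 v

/-- The coordinates of vertex `u` in copy `c`: its distances to all vertices, and, at the two
positions given by the digits of `c` to the base `P`, its distance to the root. -/
def copyCoord (w : Fin n → Fin n → ℕ) (c : Fin (P * P)) (u : Fin n) (q : ℕ) : ℕ :=
  if h : q < n then w u ⟨q, h⟩
  else if q = n + c.divNat ∨ q = n + P + c.modNat then w u 0 else 0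

theorem copyCoord_vertex (c : Fin (P * P)) (u v : Fin n) : copyCoord w c u v = w u v := by
  simp [copyCoord]

theorem copyCoord_le_root (hw : IsRootedSemimetric P w) (c : Fin (P * P)) (u : Fin n) (q : ℕ) :
    copyCoord w c u q ≤ w u 0 := by
  unfold copyCoord
  split_ifs
  exacts [hw.le_root _ _, le_rfl, Nat.zero_le _]

theorem copyCoord_le (hw : IsRootedSemimetric P w) (c : Fin (P * P)) (u : Fin n) (q : ℕ) :
    copyCoord w c u q ≤ P :=
  (copyCoord_le_root hw c u q).trans (hw.le u 0)

theorem copyCoord_le_add (hw : IsRootedSemimetric P w) (c : Fin (P * P)) (u v : Fin n) (q : ℕ) :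
    copyCoord w c u q ≤ copyCoord w c v q + w u v := by
  unfold copyCoord
  split_ifs
  · rw [add_comm]; exact hw.triangle _ _ _
  · rw [add_comm]; exact hw.triangle _ _ _
  · exact Nat.zero_le _

theorem exists_copyCoord_eq_root {c c' : Fin (P * P)} (h : c ≠ c') :
    ∃ q < n + 2 * P, ∀ (w : Fin n → Fin n → ℕ) (u v : Fin n),
      copyCoord w c u q = w u 0 ∧ copyCoord w c' v q = 0 := by
  have := c.divNat.is_lt
  have := c'.divNat.is_lt
  have := c.modNat.is_lt
  by_cases hdiv : c.divNat = c'.divNat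
  · have hmod : (c.modNat : ℕ) ≠ c'.modNat := fun hmod =>
      h (finProdFinEquiv.symm.injective (Prod.ext hdiv (Fin.ext hmod)))
    refine ⟨n + P + c.modNat, by omega, fun w u v => ⟨?_, ?_⟩⟩
    · rw [copyCoord, dif_neg (by omega), if_pos (Or.inr rfl)]
    · rw [copyCoord, dif_neg (by omega), if_neg (by omega)]
  · have hdiv' : (c.divNat : ℕ) ≠ c'.divNat := Fin.val_ne_of_ne hdiv
    refine ⟨n + c.divNat, by omega, fun w u v => ⟨?_, ?_⟩⟩
    · rw [copyCoord, dif_neg (by omega), if_pos (Or.inl rfl)]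
    · rw [copyCoord, dif_neg (by omega), if_neg (by omega)]

variable [NeZero P]

instance : NeZero (n + 2 * P) := ⟨by have := NeZero.ne n; omega⟩

/-- The flowshop instance that consists of `P * P` copies of the semimetric `w`; the job with the
number `c * n + u` stands for vertex `u` of copy `c`. -/
abbrev NWFS.copies (P : ℕ) [NeZero P] (w : Fin n → Fin n → ℕ) : NWFS :=
  NWFS.ofCoords (n + 2 * P) P fun j : Fin (P * P * n) => copyCoord w j.divNat j.modNat

theorem delay_copies_le_of_copy_eq (hw : IsRootedSemimetric P w) {i j : Fin (P * P * n)}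
    (h : i.divNat = j.divNat) :
    (NWFS.copies P w).delay i j ≤ (w i.modNat j.modNat + 2 : ℕ) :=
  delay_ofCoords_le (fun j => copyCoord_le hw j.divNat j.modNat) fun q => by
    rw [h]; exact copyCoord_le_add hw _ _ _ q

theorem delay_copies_le (hw : IsRootedSemimetric P w) (i j : Fin (P * P * n)) :
    (NWFS.copies P w).delay i j ≤ (w i.modNat 0 + 2 : ℕ) :=
  delay_ofCoords_le (fun j => copyCoord_le hw j.divNat j.modNat) fun q =>
    (copyCoord_le_root hw _ _ q).trans (Nat.le_add_left _ _)

theorem le_delay_copies_of_copy_eq (hw : IsRootedSemimetric P w) {i j : Fin (P * P * n)}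
    (h : i.divNat = j.divNat) :
    (w i.modNat j.modNat : ℤ) ≤ (NWFS.copies P w).delay i j := by
  have := le_delay_ofCoords (m := n + 2 * P) (fun j => copyCoord_le hw j.divNat j.modNat) i j
    (q := j.modNat) (by omega)
  rwa [h, copyCoord_vertex, copyCoord_vertex, hw.self, Nat.cast_zero, sub_zero] at this

theorem le_delay_copies_of_copy_ne (hw : IsRootedSemimetric P w) {i j : Fin (P * P * n)}
    (h : i.divNat ≠ j.divNat) :
    (w i.modNat 0 : ℤ) ≤ (NWFS.copies P w).delay i j := by
  obtain ⟨q, hq, coord⟩ := exists_copyCoord_eq_root (n := n) h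
  have := le_delay_ofCoords (fun j => copyCoord_le hw j.divNat j.modNat) i j hq
  rwa [(coord w i.modNat j.modNat).1, (coord w i.modNat j.modNat).2, Nat.cast_zero, sub_zero]
    at this

theorem jobLength_copies (hw : IsRootedSemimetric P w) (j : Fin (P * P * n)) :
    (NWFS.copies P w).jobLength j = ((n + 2 * P) * (2 * P) : ℕ) :=
  jobLength_ofCoords (fun j => copyCoord_le hw j.divNat j.modNat) j

theorem size_copies_le (hw : IsRootedSemimetric P w) :
    (NWFS.copies P w).size ≤ P * P * n * ((n + 2 * P) * (2 * P)) * 3 :=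
  size_ofCoords_le fun j => copyCoord_le hw j.divNat j.modNat

end Copies

section Split

variable {K n : ℕ} (σ : Equiv.Perm (Fin (K * n)))

/-- The job at position `k` belongs to copy `c`. -/
def InCopy (c : Fin K) (k : ℕ) : Prop := ∃ h : k < K * n, (σ ⟨k, h⟩).divNat = c

noncomputable instance (c : Fin K) : DecidablePred (InCopy σ c) := Classical.decPred _

theorem inCopy_divNat (k : Fin (K * n)) : InCopy σ (σ k).divNat k := ⟨k.is_lt, rfl⟩

/-- The number of jobs of copy `c` before position `k`. -/
noncomputable def copyRank (c : Fin K) (k : ℕ) : ℕ := Nat.count (InCopy σ c) k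

theorem copyRank_le (c : Fin K) (k : ℕ) : copyRank σ c k ≤ n := by
  rw [copyRank, Nat.count_eq_card_filter_range]
  refine (Finset.card_le_card_of_forall_subsingleton (t := (Finset.univ : Finset (Fin n)))
    (fun k u => ∃ h : k < K * n, (σ ⟨k, h⟩).modNat = u) ?_ ?_).trans_eq (Finset.card_fin n)
  · intro k hk
    obtain ⟨h, -⟩ := (Finset.mem_filter.1 hk).2
    exact ⟨_, Finset.mem_univ _, h, rfl⟩
  · rintro u - k ⟨hk, h, hu⟩ k' ⟨hk', h', hu'⟩
    obtain ⟨_, hc⟩ := (Finset.mem_filter.1 hk).2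
    obtain ⟨_, hc'⟩ := (Finset.mem_filter.1 hk').2
    have := σ.injective (finProdFinEquiv.symm.injective
      (Prod.ext (hc.trans hc'.symm) (hu.trans hu'.symm)))
    exact congrArg Fin.val this

theorem copyRank_succ (k : Fin (K * n)) :
    copyRank σ (σ k).divNat (k + 1) = copyRank σ (σ k).divNat k + 1 :=
  Nat.count_succ_eq_succ_count_iff.2 (inCopy_divNat σ k)

theorem copyRank_lt (k : Fin (K * n)) : copyRank σ (σ k).divNat k < n := by
  have := copyRank_le σ (σ k).divNat (k + 1)
  rwa [copyRank_succ] at this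

theorem copyRank_zero (c : Fin K) : copyRank σ c 0 = 0 := Nat.count_zero _

theorem copyRank_succ_of_ne {c : Fin K} {k : Fin (K * n)} (h : c ≠ (σ k).divNat) :
    copyRank σ c (k + 1) = copyRank σ c k :=
  Nat.count_succ_eq_count_iff.2 fun ⟨_, hc⟩ => h hc.symm

/-- Assigns to a position of the job order its copy and its position within the tour of that
copy. -/
noncomputable def copyPosition : Fin (K * n) ≃ Fin K × Fin n :=
  Equiv.ofBijective (fun k => ((σ k).divNat, ⟨copyRank σ (σ k).divNat k, copyRank_lt σ k⟩))
    ((Fintype.bijective_iff_injective_and_card _).2 ⟨fun k k' h => by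
      simp only [Prod.mk.injEq, Fin.mk.injEq] at h
      obtain ⟨copy_eq, rank_eq⟩ := h
      rw [copy_eq] at rank_eq
      exact Fin.ext (Nat.count_injective (copy_eq ▸ inCopy_divNat σ k) (inCopy_divNat σ k')
        rank_eq), by simp⟩)

theorem copyPosition_fst (k : Fin (K * n)) : (copyPosition σ k).1 = (σ k).divNat := rfl

theorem copyPosition_snd (k : Fin (K * n)) :
    ((copyPosition σ k).2 : ℕ) = copyRank σ (σ k).divNat k := rfl

theorem divNat_copyPosition_symm (c : Fin K) (i : Fin n) :
    (σ ((copyPosition σ).symm (c, i))).divNat = c := by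
  rw [← copyPosition_fst, Equiv.apply_symm_apply]

/-- The order in which the schedule visits the vertices of copy `c`. -/
noncomputable def copyTour (c : Fin K) : Equiv.Perm (Fin n) :=
  Equiv.ofBijective (fun i => (σ ((copyPosition σ).symm (c, i))).modNat)
    (Finite.injective_iff_bijective.1 fun i i' h => by
      have jobs_eq := finProdFinEquiv.symm.injective (Prod.ext
        ((divNat_copyPosition_symm σ c i).trans (divNat_copyPosition_symm σ c i').symm) h)
      simpa using jobs_eq)

theorem copyTour_copyPosition (k : Fin (K * n)) :
    copyTour σ (copyPosition σ k).1 (copyPosition σ k).2 = (σ k).modNat := by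
  simp [copyTour]

theorem copyTour_finRotate {k : Fin (K * n)} (hk : (k : ℕ) + 1 < K * n)
    (h : (σ k).divNat = (σ ⟨k + 1, hk⟩).divNat) :
    copyTour σ (copyPosition σ k).1 (finRotate n (copyPosition σ k).2) =
      (σ ⟨k + 1, hk⟩).modNat := by
  have copy_eq : (copyPosition σ k).1 = (copyPosition σ ⟨k + 1, hk⟩).1 := h
  have rank_eq : ((copyPosition σ ⟨k + 1, hk⟩).2 : ℕ) = (copyPosition σ k).2 + 1 := by
    rw [copyPosition_snd, copyPosition_snd, ← h]
    exact copyRank_succ σ k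
  have : NeZero n := ⟨(copyPosition σ k).2.pos.ne'⟩
  have rotate_eq : finRotate n (copyPosition σ k).2 = (copyPosition σ ⟨k + 1, hk⟩).2 := by
    rw [finRotate_apply]
    ext
    rw [rank_eq, Fin.val_add_one_of_lt' (rank_eq ▸ Fin.is_lt _)]
  rw [copy_eq, rotate_eq, copyTour_copyPosition]

end Split

section RepeatOrder

variable {K n : ℕ}

theorem sum_modNat {M : Type*} [AddCommMonoid M] (f : Fin n → M) :
    ∑ k : Fin (K * n), f k.modNat = K • ∑ i, f i := by
  calc ∑ k : Fin (K * n), f k.modNat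
      = ∑ x : Fin K × Fin n, f x.2 :=
        Equiv.sum_comp finProdFinEquiv.symm fun x : Fin K × Fin n => f x.2
    _ = K • ∑ i, f i := by simp [Fintype.sum_prod_type]

theorem modNat_succ [NeZero n] (k : Fin (K * n)) (h : (k : ℕ) + 1 < K * n) :
    (k.divNat = (⟨k + 1, h⟩ : Fin (K * n)).divNat ∧
      finRotate n k.modNat = (⟨k + 1, h⟩ : Fin (K * n)).modNat) ∨ finRotate n k.modNat = 0 := by
  have lt := k.modNat.is_lt
  rw [finRotate_apply]
  rcases (Nat.succ_le_of_lt lt).lt_or_eq with hlt | heq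
  · refine Or.inl ?_
    obtain ⟨div_eq, mod_eq⟩ := (Nat.div_mod_unique (a := (k : ℕ) + 1) (b := n) (c := k % n + 1)
      (d := k / n) (Nat.pos_of_neZero n)).2 ⟨by have := Nat.mod_add_div k n; omega, hlt⟩
    exact ⟨Fin.ext div_eq.symm, Fin.ext ((Fin.val_add_one_of_lt' hlt).trans mod_eq.symm)⟩
  · refine Or.inr (Fin.ext ?_)
    rw [Fin.val_add_eq_ite, Fin.val_one', Fin.val_zero]
    have := Nat.pos_of_neZero n
    rcases Nat.eq_or_lt_of_le this with h1 | h1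
    · simp [← h1, Nat.mod_one]
    · rw [Nat.mod_eq_of_lt h1, if_pos heq.ge]
      omega

/-- The job order that processes the copies one after the other, each in the order `ρ`. -/
def repeatOrder (K : ℕ) (ρ : Equiv.Perm (Fin n)) : Equiv.Perm (Fin (K * n)) :=
  (finProdFinEquiv.symm.trans (Equiv.prodCongr (Equiv.refl (Fin K)) ρ)).trans finProdFinEquiv

variable (ρ : Equiv.Perm (Fin n)) (k : Fin (K * n))

theorem finProdFinEquiv_symm_repeatOrder :
    finProdFinEquiv.symm (repeatOrder K ρ k) = (k.divNat, ρ k.modNat) := by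
  simp [repeatOrder]

theorem divNat_repeatOrder : (repeatOrder K ρ k).divNat = k.divNat :=
  congrArg Prod.fst (finProdFinEquiv_symm_repeatOrder ρ k)

theorem modNat_repeatOrder : (repeatOrder K ρ k).modNat = ρ k.modNat :=
  congrArg Prod.snd (finProdFinEquiv_symm_repeatOrder ρ k)

end RepeatOrder

section CopiesMakespan

variable {n P : ℕ} [NeZero n] [NeZero P] {w : Fin n → Fin n → ℕ}

theorem sum_tourWeight_copyTour_le_makespan (hw : IsRootedSemimetric P w)
    (σ : Equiv.Perm (Fin (P * P * n))) :
    ((∑ c, tourWeight w (copyTour σ c) : ℕ) : ℤ) ≤ (NWFS.copies P w).makespan σ := by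
  simp only [tourWeight]
  rw [← Fintype.sum_prod_type', Nat.cast_sum, ← (copyPosition σ).sum_comp]
  simp only [copyTour_copyPosition]
  refine NWFS.le_makespan (I := NWFS.copies P w) σ (fun k h => ?_) fun k => ?_
  · by_cases copy_eq : (σ k).divNat = (σ ⟨k + 1, h⟩).divNat
    · rw [copyTour_finRotate σ h copy_eq]
      exact le_delay_copies_of_copy_eq hw copy_eq
    · exact (Nat.cast_le.2 (hw.le_root _ _)).trans (le_delay_copies_of_copy_ne hw copy_eq)
  · rw [jobLength_copies hw]
    have machines_ge : P ≤ (n + 2 * P) * (2 * P) := by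
      nlinarith [Nat.pos_of_neZero n, Nat.pos_of_neZero P]
    exact_mod_cast (hw.le _ _).trans machines_ge

theorem opt_copies_le (hw : IsRootedSemimetric P w) {ρ : Equiv.Perm (Fin n)} (hρ : ρ 0 = 0) :
    (NWFS.copies P w).opt ≤
      ((P * P * (tourWeight w ρ + 2 * n) + (n + 2 * P) * (2 * P) : ℕ) : ℤ) := by
  let f (i : Fin n) : ℕ := w (ρ i) (ρ (finRotate n i)) + 2
  have sum_f : ∑ k : Fin (P * P * n), (f k.modNat : ℤ) =
      ((P * P * (tourWeight w ρ + 2 * n) : ℕ) : ℤ) := by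
    rw [sum_modNat fun i => (f i : ℤ)]
    simp [f, tourWeight, Finset.sum_add_distrib, mul_comm]
  rw [Nat.cast_add, ← sum_f]
  refine (Finset.inf'_le _ (Finset.mem_univ (repeatOrder (P * P) ρ))).trans
    (NWFS.makespan_le (I := NWFS.copies P w) _ (fun k => Int.natCast_nonneg _) (fun k h => ?_)
      fun j => (jobLength_copies hw j).le)
  rcases modNat_succ k h with ⟨copy_eq, rotate_eq⟩ | rotate_eq
  · refine (delay_copies_le_of_copy_eq hw ?_).trans_eq ?_
    · rw [divNat_repeatOrder, divNat_repeatOrder]; exact copy_eq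
    · rw [modNat_repeatOrder, modNat_repeatOrder]; simp only [f, rotate_eq]
  · refine (delay_copies_le hw _ _).trans_eq ?_
    rw [modNat_repeatOrder]
    simp only [f, rotate_eq, hρ]

end CopiesMakespan

namespace ATSP

variable (G : ATSP)

instance : NeZero G.n := ⟨G.n_pos.ne'⟩

/-- The arc weights after a shift by the potential `v ↦ d 0 v`, which makes the arcs from the root
`0` free. -/
def shifted (u v : Fin G.n) : ℝ := G.d u v + G.d 0 u - G.d 0 v

theorem shifted_self (u : Fin G.n) : G.shifted u u = 0 := by simp [shifted, G.d_self]

theorem shifted_root (v : Fin G.n) : G.shifted 0 v = 0 := by simp [shifted, G.d_self]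

theorem shifted_triangle (u v x : Fin G.n) : G.shifted u x ≤ G.shifted u v + G.shifted v x := by
  have := G.triangle u v x
  unfold shifted
  linarith

theorem shifted_nonneg (u v : Fin G.n) : 0 ≤ G.shifted u v := by
  have := G.triangle 0 u v
  unfold shifted
  linarith

theorem shifted_le_root (u v : Fin G.n) : G.shifted u v ≤ G.shifted u 0 := by
  simpa [G.shifted_root] using G.shifted_triangle u 0 v

theorem tourWeight_shifted (τ : Equiv.Perm (Fin G.n)) :
    tourWeight G.shifted τ = G.tourLength τ :=
  tourWeight_add_potential G.d (G.d 0) τ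

/-- The maximum of the shifted arc weights. -/
noncomputable def diam : ℝ := Finset.univ.sup' Finset.univ_nonempty fun u => G.shifted u 0

theorem shifted_le_diam (u v : Fin G.n) : G.shifted u v ≤ G.diam :=
  (G.shifted_le_root u v).trans (Finset.le_sup' (fun u => G.shifted u 0) (Finset.mem_univ u))

theorem diam_nonneg : 0 ≤ G.diam := (G.shifted_nonneg 0 0).trans (G.shifted_le_diam 0 0)

theorem diam_le_opt : G.diam ≤ G.opt :=
  Finset.le_inf' _ _ fun τ _ => Finset.sup'_le _ _ fun u _ => by
    rw [← tourWeight_shifted]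
    exact le_tourWeight_of_triangle G.shifted_triangle G.shifted_self G.shifted_nonneg τ u 0

theorem exists_tourLength_eq_opt :
    ∃ ρ : Equiv.Perm (Fin G.n), ρ 0 = 0 ∧ G.tourLength ρ = G.opt := by
  obtain ⟨τ, -, hτ⟩ := Finset.exists_mem_eq_inf' Finset.univ_nonempty G.tourLength
  obtain ⟨ρ, hρ, hρτ⟩ := exists_tourWeight_eq_of_apply_zero G.d τ 0
  exact ⟨ρ, hρ, hρτ.trans hτ.symm⟩

/-- An upper bound for the rounded weights; the instance consists of `scale * scale` copies. -/
noncomputable def scale (ε : ℝ) : ℕ := G.n * (⌊9 / ε⌋₊ + 1)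

/-- The arc weights in units of `diam / scale`, rounded up. If `diam = 0` then all shifted weights
vanish, and so do these, since division by zero yields zero. -/
noncomputable def weight (ε : ℝ) (u v : Fin G.n) : ℕ := ⌈G.scale ε * G.shifted u v / G.diam⌉₊

variable {ε : ℝ}

instance : NeZero (G.scale ε) := ⟨(Nat.mul_pos G.n_pos (Nat.succ_pos _)).ne'⟩

theorem scale_pos : (0 : ℝ) < G.scale ε := Nat.cast_pos.2 (Nat.pos_of_neZero _)

theorem n_le_scale : G.n ≤ G.scale ε := Nat.le_mul_of_pos_right _ (Nat.succ_pos _)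

theorem nine_mul_le_scale_mul (hε : 0 < ε) : 9 * G.n ≤ G.scale ε * ε := by
  have nine_le := ((div_lt_iff₀ hε).1 (Nat.lt_floor_add_one (9 / ε))).le
  calc 9 * (G.n : ℝ) ≤ (⌊9 / ε⌋₊ + 1) * ε * G.n := by gcongr
    _ = G.scale ε * ε := by rw [scale]; push_cast; ring

theorem isRootedSemimetric_weight (ε : ℝ) : IsRootedSemimetric (G.scale ε) (G.weight ε) where
  self u := by simp [weight, G.shifted_self]
  root v := by simp [weight, G.shifted_root]
  triangle u v x := by
    refine (Nat.ceil_mono ?_).trans (Nat.ceil_add_le _ _)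
    rw [← add_div, ← mul_add]
    exact div_le_div_of_nonneg_right
      (mul_le_mul_of_nonneg_left (G.shifted_triangle u v x) (Nat.cast_nonneg _)) G.diam_nonneg
  le u v := Nat.ceil_le.2 (div_le_of_le_mul₀ G.diam_nonneg (Nat.cast_nonneg _)
    (mul_le_mul_of_nonneg_left (G.shifted_le_diam u v) (Nat.cast_nonneg _)))

theorem scale_mul_shifted_le (u v : Fin G.n) :
    G.scale ε * G.shifted u v ≤ G.weight ε u v * G.diam := by
  rcases G.diam_nonneg.eq_or_lt with h | h
  · rw [← h, mul_zero]
    exact mul_nonpos_of_nonneg_of_nonpos (Nat.cast_nonneg _) ((G.shifted_le_diam u v).trans h.ge)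
  · exact (div_le_iff₀ h).1 (Nat.le_ceil _)

theorem weight_mul_diam_le (u v : Fin G.n) :
    G.weight ε u v * G.diam ≤ G.scale ε * G.shifted u v + G.diam := by
  have scaled_nonneg := mul_nonneg (Nat.cast_nonneg (α := ℝ) (G.scale ε)) (G.shifted_nonneg u v)
  rcases G.diam_nonneg.eq_or_lt with h | h
  · simpa [← h] using scaled_nonneg
  · calc G.weight ε u v * G.diam
        ≤ (G.scale ε * G.shifted u v / G.diam + 1) * G.diam := by
          gcongr
          exact (Nat.ceil_lt_add_one (div_nonneg scaled_nonneg h.le)).le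
      _ = G.scale ε * G.shifted u v + G.diam := by field_simp

theorem scale_mul_tourLength_le (τ : Equiv.Perm (Fin G.n)) :
    G.scale ε * G.tourLength τ ≤ tourWeight (G.weight ε) τ * G.diam := by
  rw [← tourWeight_shifted, tourWeight, tourWeight, Finset.mul_sum, Nat.cast_sum, Finset.sum_mul]
  exact Finset.sum_le_sum fun _ _ => G.scale_mul_shifted_le _ _

theorem tourWeight_mul_diam_le (τ : Equiv.Perm (Fin G.n)) :
    tourWeight (G.weight ε) τ * G.diam ≤ G.scale ε * G.tourLength τ + G.n * G.diam := by
  rw [← tourWeight_shifted, tourWeight, tourWeight, Finset.mul_sum, Nat.cast_sum, Finset.sum_mul]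
  refine (Finset.sum_le_sum fun _ _ => G.weight_mul_diam_le _ _).trans (le_of_eq ?_)
  simp [Finset.sum_add_distrib]

/-- The flowshop instance that is constructed from `G` and `ε`. -/
noncomputable abbrev toNWFS (ε : ℝ) : NWFS := NWFS.copies (G.scale ε) (G.weight ε)

theorem opt_toNWFS_mul_diam_le (hε : 0 < ε) :
    (G.toNWFS ε).opt * G.diam ≤ G.scale ε ^ 3 * (1 + ε) * G.opt := by
  obtain ⟨ρ, hρ, hopt⟩ := G.exists_tourLength_eq_opt
  have opt_le : ((G.toNWFS ε).opt : ℝ) ≤ _ :=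
    Int.cast_le.2 (opt_copies_le (G.isRootedSemimetric_weight ε) hρ)
  have weight_le := G.tourWeight_mul_diam_le (ε := ε) ρ
  rw [hopt] at weight_le
  have diam_nonneg := G.diam_nonneg
  have diam_le := G.diam_le_opt
  have n_le : (G.n : ℝ) ≤ G.scale ε := Nat.cast_le.2 G.n_le_scale
  have nine_le := G.nine_mul_le_scale_mul hε
  have one_le : (1 : ℝ) ≤ G.n := Nat.one_le_cast.2 G.n_pos
  push_cast at opt_le
  set P := (G.scale ε : ℝ)
  set n := (G.n : ℝ)
  set W := ((tourWeight (G.weight ε) ρ : ℕ) : ℝ)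
  calc ((G.toNWFS ε).opt : ℝ) * G.diam
      ≤ (P * P * (W + 2 * n) + (n + 2 * P) * (2 * P)) * G.diam := by gcongr
    _ = P * P * (W * G.diam) + (P * P * (2 * n) + (n + 2 * P) * (2 * P)) * G.diam := by ring
    _ ≤ P * P * (P * G.opt + n * G.diam) +
        (P * P * (2 * n) + (P + 2 * P) * (2 * P)) * G.diam := by gcongr
    _ = P ^ 3 * G.opt + P * P * (3 * n + 6) * G.diam := by ring
    _ ≤ P ^ 3 * G.opt + P * P * (P * ε) * G.opt := by
        have : 3 * n + 6 ≤ P * ε := by linarith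
        gcongr
    _ = P ^ 3 * (1 + ε) * G.opt := by ring

theorem tourLength_copyTour_le (hε : 0 < ε) {α : ℝ} (hα : 0 ≤ α)
    {σ : Equiv.Perm (Fin (G.toNWFS ε).jobs)} (hσ : (G.toNWFS ε).IsApprox α σ)
    {c : Fin (G.scale ε * G.scale ε)}
    (hc : ∀ c', G.tourLength (copyTour σ c) ≤ G.tourLength (copyTour σ c')) :
    G.tourLength (copyTour σ c) ≤ α * (1 + ε) * G.opt := by
  have sum_le : ((∑ c, tourWeight (G.weight ε) (copyTour σ c) : ℕ) : ℝ) ≤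
      (G.toNWFS ε).makespan σ := by
    exact_mod_cast sum_tourWeight_copyTour_le_makespan (G.isRootedSemimetric_weight ε) σ
  refine le_of_mul_le_mul_left ?_ (pow_pos (G.scale_pos (ε := ε)) 3)
  calc (G.scale ε : ℝ) ^ 3 * G.tourLength (copyTour σ c)
      = ∑ _c' : Fin (G.scale ε * G.scale ε), G.scale ε * G.tourLength (copyTour σ c) := by
        simp; ring
    _ ≤ ∑ c', (tourWeight (G.weight ε) (copyTour σ c') : ℕ) * G.diam :=
        Finset.sum_le_sum fun c' _ =>
          (mul_le_mul_of_nonneg_left (hc c') G.scale_pos.le).trans (G.scale_mul_tourLength_le _)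
    _ = (∑ c', tourWeight (G.weight ε) (copyTour σ c') : ℕ) * G.diam := by
        rw [Nat.cast_sum, Finset.sum_mul]
    _ ≤ α * (G.toNWFS ε).opt * G.diam :=
        mul_le_mul_of_nonneg_right (sum_le.trans hσ) G.diam_nonneg
    _ = α * ((G.toNWFS ε).opt * G.diam) := mul_assoc ..
    _ ≤ α * (G.scale ε ^ 3 * (1 + ε) * G.opt) :=
        mul_le_mul_of_nonneg_left (G.opt_toNWFS_mul_diam_le hε) hα
    _ = G.scale ε ^ 3 * (α * (1 + ε) * G.opt) := by ring

end ATSP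

/-! ### Programs -/

section Notation

instance : Add NExp := ⟨.add⟩
instance : Sub NExp := ⟨.sub⟩
instance (c : ℕ) : OfNat NExp c := ⟨.const c⟩
instance : Add RExp := ⟨.add⟩
instance : Sub RExp := ⟨.sub⟩
instance (c : ℕ) : OfNat RExp c := ⟨.const c⟩

infixr:60 ";;" => Program.seq

/-- The variable `x` is the first cell of the array `x`. -/
abbrev NExp.var (x : ℕ) : NExp := .read x 0 0

/-- The real variable `x` is the first cell of the real array `x`. -/
abbrev RExp.var (x : ℕ) : RExp := .read x 0 0

/-- The assignment of `e` to the variable `x`. -/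
abbrev Program.setVar (x : ℕ) (e : NExp) : Program := .setNat x 0 0 e

/-- The assignment of `e` to the real variable `x`. -/
abbrev Program.setRealVar (x : ℕ) (e : RExp) : Program := .setReal x 0 0 e

/-- The comparison `a < b` of natural numbers, expressed by `≤`. -/
abbrev Test.natLt (a b : NExp) : Test := .natLe (a + 1) b

/-- The comparison `a = b` of natural numbers, expressed by `≤`. -/
def Test.natEq (a b : NExp) : Test := .and (.natLe a b) (.natLe b a)

/-- Disjunction of tests, which the machine offers only through `and` and `not`. -/
def Test.or (a b : Test) : Test := .not (.and (.not a) (.not b))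

variable (s : State)

@[simp] theorem NExp.eval_read (x : ℕ) (i j : NExp) :
    (NExp.read x i j).eval s = s.nat x (i.eval s) (j.eval s) := rfl
@[simp] theorem NExp.eval_add (a b : NExp) : (a + b).eval s = a.eval s + b.eval s := rfl
@[simp] theorem NExp.eval_sub (a b : NExp) : (a - b).eval s = a.eval s - b.eval s := rfl
@[simp] theorem NExp.eval_ofNat (c : ℕ) : (ofNat(c) : NExp).eval s = c := rfl

@[simp] theorem RExp.eval_read (x : ℕ) (i j : NExp) :
    (RExp.read x i j).eval s = s.real x (i.eval s) (j.eval s) := rfl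
@[simp] theorem RExp.eval_add (a b : RExp) : (a + b).eval s = a.eval s + b.eval s := rfl
@[simp] theorem RExp.eval_sub (a b : RExp) : (a - b).eval s = a.eval s - b.eval s := rfl
@[simp] theorem RExp.eval_ofNat (c : ℕ) : (ofNat(c) : RExp).eval s = c := rfl

@[simp] theorem Test.eval_natLe (a b : NExp) :
    (Test.natLe a b).eval s ↔ a.eval s ≤ b.eval s := Iff.rfl
@[simp] theorem Test.eval_realLe (a b : RExp) :
    (Test.realLe a b).eval s ↔ a.eval s ≤ b.eval s := Iff.rfl
@[simp] theorem Test.eval_not (b : Test) : b.not.eval s ↔ ¬ b.eval s := Iff.rfl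
@[simp] theorem Test.eval_and (b c : Test) : (b.and c).eval s ↔ b.eval s ∧ c.eval s := Iff.rfl
@[simp] theorem Test.eval_natEq (a b : NExp) :
    (Test.natEq a b).eval s ↔ a.eval s = b.eval s := Nat.le_antisymm_iff.symm
@[simp] theorem Test.eval_or (b c : Test) : (b.or c).eval s ↔ b.eval s ∨ c.eval s :=
  or_iff_not_and_not.symm

@[simp] theorem State.setNat_nat (x i j v x' i' j' : ℕ) : (s.setNat x i j v).nat x' i' j' =
    if x' = x ∧ i' = i ∧ j' = j then v else s.nat x' i' j' := rfl
@[simp] theorem State.setReal_nat (x i j : ℕ) (v : ℝ) : (s.setReal x i j v).nat = s.nat := rfl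
@[simp] theorem State.setReal_real (x i j : ℕ) (v : ℝ) (x' i' j' : ℕ) :
    (s.setReal x i j v).real x' i' j' =
      if x' = x ∧ i' = i ∧ j' = j then v else s.real x' i' j' := rfl

end Notation

section Frame

/-- The natural-number arrays to which a program assigns. -/
def Program.natTargets : Program → List ℕ
  | .skip | .setReal _ _ _ _ => []
  | .setNat x _ _ _ => [x]
  | .seq p q | .ite _ p q => p.natTargets ++ q.natTargets
  | .loop _ p => p.natTargets

/-- The real arrays to which a program assigns. -/
def Program.realTargets : Program → List ℕ
  | .skip | .setNat _ _ _ _ => []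
  | .setReal x _ _ _ => [x]
  | .seq p q | .ite _ p q => p.realTargets ++ q.realTargets
  | .loop _ p => p.realTargets

/-- The states agree on all arrays to which the program does not assign. -/
structure Frame (p : Program) (s s' : State) : Prop where
  nat : ∀ (x : ℕ) (_ : x ∉ p.natTargets := by decide), s'.nat x = s.nat x
  real : ∀ (x : ℕ) (_ : x ∉ p.realTargets := by decide), s'.real x = s.real x

variable {p q : Program} {s s' s'' : State}

theorem Frame.refl (p : Program) (s : State) : Frame p s s :=
  ⟨fun _ _ => rfl, fun _ _ => rfl⟩

theorem Frame.trans (h : Frame p s s') (h' : Frame p s' s'') : Frame p s s'' :=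
  ⟨fun x hx => (h'.nat x hx).trans (h.nat x hx), fun x hx => (h'.real x hx).trans (h.real x hx)⟩

theorem Frame.mono (h : Frame p s s') (hn : p.natTargets ⊆ q.natTargets)
    (hr : p.realTargets ⊆ q.realTargets) : Frame q s s' :=
  ⟨fun x hx => h.nat x fun hp => hx (hn hp), fun x hx => h.real x fun hp => hx (hr hp)⟩

theorem frame_setNat (x i j v : ℕ) (hx : x ∈ p.natTargets) : Frame p s (s.setNat x i j v) where
  nat y hy := by
    have hyx : y ≠ x := by rintro rfl; exact hy hx
    ext; simp [hyx]
  real _ _ := rfl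

theorem frame_setReal (x i j : ℕ) (v : ℝ) (hx : x ∈ p.realTargets) :
    Frame p s (s.setReal x i j v) where
  nat _ _ := rfl
  real y hy := by
    have hyx : y ≠ x := by rintro rfl; exact hy hx
    ext; simp [hyx]

theorem Exec.frame {T : ℕ} (h : Exec p s s' T) : Frame p s s' := by
  induction h with
  | skip s => exact .refl _ _
  | setNat s x i j e => exact frame_setNat _ _ _ _ (by simp [Program.natTargets])
  | setReal s x i j e => exact frame_setReal _ _ _ _ (by simp [Program.realTargets])
  | seq _ _ ih ih' =>
    exact (ih.mono (by simp [Program.natTargets]) (by simp [Program.realTargets])).trans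
      (ih'.mono (by simp [Program.natTargets]) (by simp [Program.realTargets]))
  | iteTrue _ _ ih | iteFalse _ _ ih =>
    exact ih.mono (by simp [Program.natTargets]) (by simp [Program.realTargets])
  | loopDone _ => exact .refl _ _
  | loopStep _ _ _ ih ih' =>
    exact Frame.trans ⟨fun x hx => ih.nat x hx, fun x hx => ih.real x hx⟩ ih'

end Frame

namespace Program.HaltsWithin

variable {p q : Program} {s : State} {b : Test} {B B' : ℝ} {P Q : State → Prop}

theorem mono (h : p.HaltsWithin s B P) (hB : B ≤ B') (hPQ : ∀ s', Frame p s s' → P s' → Q s') :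
    p.HaltsWithin s B' Q := by
  obtain ⟨s', T, e, hT, hP⟩ := h
  exact ⟨s', T, e, hT.trans hB, hPQ s' e.frame hP⟩

theorem skip (h : Q s) : Program.skip.HaltsWithin s 1 Q :=
  ⟨_, _, .skip s, by simp, h⟩

theorem setNat {x : ℕ} {i j e : NExp} (h : Q (s.setNat x (i.eval s) (j.eval s) (e.eval s))) :
    (Program.setNat x i j e).HaltsWithin s 1 Q :=
  ⟨_, _, .setNat s x i j e, by simp, h⟩

theorem setReal {x : ℕ} {i j : NExp} {e : RExp}
    (h : Q (s.setReal x (i.eval s) (j.eval s) (e.eval s))) :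
    (Program.setReal x i j e).HaltsWithin s 1 Q :=
  ⟨_, _, .setReal s x i j e, by simp, h⟩

theorem seq (hp : p.HaltsWithin s B P) (hq : ∀ s', Frame p s s' → P s' → q.HaltsWithin s' B' Q) :
    (p ;; q).HaltsWithin s (B + B') Q := by
  obtain ⟨s', T, e, hT, hP⟩ := hp
  obtain ⟨s'', T', e', hT', hQ⟩ := hq s' e.frame hP
  exact ⟨s'', T + T', e.seq e', by push_cast; linarith, hQ⟩

theorem setVar_seq {x : ℕ} {e : NExp}
    (h : ∀ s', Frame (.setVar x e) s s' → s'.nat x 0 0 = e.eval s → q.HaltsWithin s' B Q) :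
    (Program.setVar x e ;; q).HaltsWithin s (1 + B) Q :=
  seq (P := fun s' => s'.nat x 0 0 = e.eval s) (setNat (by simp)) h

theorem setRealVar_seq {x : ℕ} {e : RExp}
    (h : ∀ s', Frame (.setRealVar x e) s s' → s'.real x 0 0 = e.eval s → q.HaltsWithin s' B Q) :
    (Program.setRealVar x e ;; q).HaltsWithin s (1 + B) Q :=
  seq (P := fun s' => s'.real x 0 0 = e.eval s) (setReal (by simp)) h

theorem ite (hp : b.eval s → p.HaltsWithin s B Q) (hq : ¬ b.eval s → q.HaltsWithin s B Q) :
    (Program.ite b p q).HaltsWithin s (B + 1) Q := by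
  by_cases hb : b.eval s
  · obtain ⟨s', T, e, hT, hQ⟩ := hp hb
    exact ⟨s', T + 1, e.iteTrue hb, by push_cast; linarith, hQ⟩
  · obtain ⟨s', T, e, hT, hQ⟩ := hq hb
    exact ⟨s', T + 1, e.iteFalse hb, by push_cast; linarith, hQ⟩

theorem loop {N : ℕ} (Inv : ℕ → State → Prop) (h0 : Inv 0 s)
    (hstep : ∀ k < N, ∀ s', Frame p s s' → Inv k s' →
      b.eval s' ∧ p.HaltsWithin s' B (Inv (k + 1)))
    (hend : ∀ s', Frame p s s' → Inv N s' → ¬ b.eval s') :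
    (Program.loop b p).HaltsWithin s (N * (B + 1) + 1) (Inv N) := by
  suffices key : ∀ m k, k + m = N → ∀ s', Frame p s s' → Inv k s' →
      (Program.loop b p).HaltsWithin s' (m * (B + 1) + 1) (Inv N) from
    key N 0 (zero_add N) s (.refl _ _) h0
  intro m
  induction m with
  | zero =>
    rintro k rfl s' hf hk
    exact ⟨s', 1, .loopDone (hend s' hf hk), by simp, hk⟩
  | succ m ih =>
    intro k hkm s' hf hk
    obtain ⟨hb, s'', T, e, hT, hk'⟩ := hstep k (by omega) s' hf hk
    obtain ⟨s₃, T', e', hT', hN⟩ := ih (k + 1) (by omega) s'' (hf.trans e.frame) hk'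
    exact ⟨s₃, _, .loopStep hb e e', by push_cast; linarith, hN⟩

end Program.HaltsWithin

section ForLoop

/-- Run `p` for the values `0, …, b - 1` of the variable `i`. -/
def Program.forLoop (i : ℕ) (b : NExp) (p : Program) : Program :=
  .setVar i 0 ;; .loop (.natLt (.var i) b) (p ;; .setVar i (.var i + 1))

theorem Program.HaltsWithin.forLoop {i : ℕ} {b : NExp} {p : Program} {s : State} {B : ℝ} (N : ℕ)
    (Inv : ℕ → State → Prop) (hi : i ∉ p.natTargets)
    (hb : ∀ s', Frame (.forLoop i b p) s s' → b.eval s' = N)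
    (hInv : ∀ k v s', Inv k s' → Inv k (s'.setNat i 0 0 v)) (h0 : Inv 0 s)
    (hstep : ∀ (k : Fin N) (s' : State), Frame (.forLoop i b p) s s' → s'.nat i 0 0 = k →
      Inv k s' → p.HaltsWithin s' B (Inv (k + 1))) :
    (Program.forLoop i b p).HaltsWithin s (N * (B + 2) + 2) (Inv N) := by
  have body {s' s'' : State} (h : Frame (p ;; .setVar i (.var i + 1)) s' s'') :
      Frame (.forLoop i b p) s' s'' :=
    h.mono (by simp [Program.forLoop, natTargets]) (by simp [Program.forLoop, realTargets])
  have start := frame_setNat (p := .forLoop i b p) (s := s) i 0 0 0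
    (by simp [Program.forLoop, natTargets])
  refine (seq (P := (· = s.setNat i 0 0 0)) (setNat rfl) (B' := N * (B + 2) + 1) ?_).mono
    (by linarith) (fun s' _ h => h.1) (P := fun s' => Inv N s' ∧ s'.nat i 0 0 = N)
  rintro _ - rfl
  refine (loop (B := B + 1) (fun k s' => Inv k s' ∧ s'.nat i 0 0 = k)
    ⟨hInv _ _ _ h0, by simp⟩ ?_ ?_).mono (by linarith) fun _ _ h => h
  · rintro k hk s' hf ⟨hinv, hik⟩
    have hf' := start.trans (body hf)
    refine ⟨by simpa [hik, hb s' hf'] using hk, seq (hstep ⟨k, hk⟩ s' hf' hik hinv)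
      fun s'' hf'' h'' => setNat ⟨hInv _ _ _ h'', by simp [hf''.nat i hi, hik]⟩⟩
  · rintro s' hf ⟨-, hik⟩
    simp [hik, hb s' (start.trans (body hf))]

end ForLoop

section Rename

/-- The expression that reads the array `f x` in place of `x`. -/
def NExp.rename (f : ℕ → ℕ) : NExp → NExp
  | .const c => .const c
  | .read x i j => .read (f x) (i.rename f) (j.rename f)
  | .add a b => .add (a.rename f) (b.rename f)
  | .sub a b => .sub (a.rename f) (b.rename f)

/-- The real expression that reads the array `f x`, respectively `g x`, in place of `x`. -/
def RExp.rename (f g : ℕ → ℕ) : RExp → RExp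
  | .const c => .const c
  | .read x i j => .read (g x) (i.rename f) (j.rename f)
  | .add a b => .add (a.rename f g) (b.rename f g)
  | .sub a b => .sub (a.rename f g) (b.rename f g)

/-- The test that reads the array `f x`, respectively `g x`, in place of `x`. -/
def Test.rename (f g : ℕ → ℕ) : Test → Test
  | .natLe a b => .natLe (a.rename f) (b.rename f)
  | .realLe a b => .realLe (a.rename f g) (b.rename f g)
  | .not b => .not (b.rename f g)
  | .and b c => .and (b.rename f g) (c.rename f g)

/-- The program that uses the natural-number array `f x` in place of `x`, and the real array `g x`
in place of `x`. -/
def Program.rename (f g : ℕ → ℕ) : Program → Program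
  | .skip => .skip
  | .setNat x i j e => .setNat (f x) (i.rename f) (j.rename f) (e.rename f)
  | .setReal x i j e => .setReal (g x) (i.rename f) (j.rename f) (e.rename f g)
  | .seq p q => .seq (p.rename f g) (q.rename f g)
  | .ite b p q => .ite (b.rename f g) (p.rename f g) (q.rename f g)
  | .loop b p => .loop (b.rename f g) (p.rename f g)

/-- The memory as a renamed program sees it. -/
def State.pull (f g : ℕ → ℕ) (s : State) : State :=
  ⟨fun x => s.nat (f x), fun x => s.real (g x)⟩

variable {f g : ℕ → ℕ}

theorem NExp.eval_rename (s : State) (e : NExp) : (e.rename f).eval s = e.eval (s.pull f g) := by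
  induction e with
  | const c => rfl
  | read x i j hi hj => simp [NExp.rename, hi, hj, State.pull]
  | add a b ha hb => simp [NExp.rename, NExp.eval, ha, hb]
  | sub a b ha hb => simp [NExp.rename, NExp.eval, ha, hb]

theorem RExp.eval_rename (s : State) (e : RExp) :
    (e.rename f g).eval s = e.eval (s.pull f g) := by
  induction e with
  | const c => rfl
  | read x i j => simp [RExp.rename, NExp.eval_rename (g := g), State.pull]
  | add a b ha hb => simp [RExp.rename, RExp.eval, ha, hb]
  | sub a b ha hb => simp [RExp.rename, RExp.eval, ha, hb]

theorem Test.eval_rename (s : State) (b : Test) :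
    (b.rename f g).eval s ↔ b.eval (s.pull f g) := by
  induction b with
  | natLe a b => simp [Test.rename, NExp.eval_rename (g := g)]
  | realLe a b => simp [Test.rename, RExp.eval_rename]
  | not b hb => simp [Test.rename, hb]
  | and b c hb hc => simp [Test.rename, hb, hc]

theorem Program.natTargets_rename (p : Program) :
    (p.rename f g).natTargets = p.natTargets.map f := by
  induction p <;> simp_all [Program.rename, Program.natTargets]

theorem Program.realTargets_rename (p : Program) :
    (p.rename f g).realTargets = p.realTargets.map g := by
  induction p <;> simp_all [Program.rename, Program.realTargets]

theorem State.pull_setNat (hf : f.Injective) (s : State) (x i j v : ℕ) :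
    (s.setNat (f x) i j v).pull f g = (s.pull f g).setNat x i j v := by
  simp only [State.pull, State.setNat, hf.eq_iff]

theorem State.pull_setReal (hg : g.Injective) (s : State) (x i j : ℕ) (v : ℝ) :
    (s.setReal (g x) i j v).pull f g = (s.pull f g).setReal x i j v := by
  simp only [State.pull, State.setReal, hg.eq_iff]

theorem Exec.rename (hf : f.Injective) (hg : g.Injective) {p : Program} {s s' : State} {T : ℕ}
    (h : Exec p s s' T) {S : State} (hS : S.pull f g = s) :
    ∃ S', Exec (p.rename f g) S S' T ∧ S'.pull f g = s' := by
  induction h generalizing S with subst hS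
  | skip s => exact ⟨S, .skip S, rfl⟩
  | setNat s x i j e =>
    exact ⟨_, .setNat S _ _ _ _, by simp only [State.pull_setNat hf, NExp.eval_rename (g := g)]⟩
  | setReal s x i j e =>
    exact ⟨_, .setReal S _ _ _ _,
      by simp only [State.pull_setReal hg, NExp.eval_rename (g := g), RExp.eval_rename]⟩
  | seq _ _ ih ih' =>
    obtain ⟨S', e, hS'⟩ := ih rfl
    obtain ⟨S'', e', hS''⟩ := ih' hS'
    exact ⟨S'', e.seq e', hS''⟩
  | iteTrue hb _ ih =>
    obtain ⟨S', e, hS'⟩ := ih rfl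
    exact ⟨S', e.iteTrue ((Test.eval_rename S _).2 hb), hS'⟩
  | iteFalse hb _ ih =>
    obtain ⟨S', e, hS'⟩ := ih rfl
    exact ⟨S', e.iteFalse (mt (Test.eval_rename S _).1 hb), hS'⟩
  | loopDone hb => exact ⟨S, .loopDone (mt (Test.eval_rename S _).1 hb), rfl⟩
  | loopStep hb _ _ ih ih' =>
    obtain ⟨S', e, hS'⟩ := ih rfl
    obtain ⟨S'', e', hS''⟩ := ih' hS'
    exact ⟨S'', .loopStep ((Test.eval_rename S _).2 hb) e e', hS''⟩

theorem Program.HaltsWithin.rename (hf : f.Injective) (hg : g.Injective) {p : Program} {s : State}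
    {B : ℝ} {Q : State → Prop} (h : p.HaltsWithin (s.pull f g) B Q) :
    (p.rename f g).HaltsWithin s B fun s' => Q (s'.pull f g) := by
  obtain ⟨_, T, e, hT, hQ⟩ := h
  obtain ⟨S', e', rfl⟩ := e.rename hf hg rfl
  exact ⟨S', T, e', hT, hQ⟩

end Rename

/-! ### Rounding the arc weights -/

-- The arrays up to `tour` are fixed by the input and output conventions of the statement;
-- `fresh` is the first array that no program below uses.
namespace Reg

abbrev numVertices : ℕ := 0
abbrev numJobs : ℕ := 1
abbrev numMachines : ℕ := 2
abbrev time : ℕ := 3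
abbrev schedule : ℕ := 4
abbrev tour : ℕ := 5
abbrev scale : ℕ := 6
abbrev vertex : ℕ := 7
abbrev target : ℕ := 8
abbrev counter : ℕ := 9
abbrev weight : ℕ := 10
abbrev ceil : ℕ := 11
abbrev digit₁ : ℕ := 12
abbrev digit₂ : ℕ := 13
abbrev coord : ℕ := 14
abbrev phase : ℕ := 15
abbrev job : ℕ := 16
abbrev copy : ℕ := 17
abbrev machine : ℕ := 18
abbrev height : ℕ := 19
abbrev jobCopy : ℕ := 20
abbrev jobVertex : ℕ := 21
abbrev filled : ℕ := 22
abbrev order : ℕ := 23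
abbrev next : ℕ := 24
abbrev best : ℕ := 25
abbrev candidate : ℕ := 26
abbrev fresh : ℕ := 27

end Reg

-- The arrays `dist` and `eps` are those of the input.
namespace RealReg

abbrev dist : ℕ := 0
abbrev eps : ℕ := 1
abbrev threshold : ℕ := 2
abbrev multiple : ℕ := 3
abbrev diam : ℕ := 4
abbrev length : ℕ := 5
abbrev minLength : ℕ := 6
abbrev shifted : ℕ := 7
abbrev fresh : ℕ := 8

end RealReg

open Program.HaltsWithin

/-- The memory contains `G` and `ε`. -/
structure State.HoldsATSP (s : State) (G : ATSP) (ε : ℝ) : Prop where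
  numVertices : s.nat Reg.numVertices 0 0 = G.n
  dist (u v : Fin G.n) : s.real RealReg.dist u v = G.d u v
  eps : s.real RealReg.eps 0 0 = ε

section Rounding

variable {G : ATSP} {ε : ℝ} {p : Program} {s s' : State}

theorem State.HoldsATSP.frame (h : s.HoldsATSP G ε) (hf : Frame p s s')
    (hn : Reg.numVertices ∉ p.natTargets := by decide)
    (hd : RealReg.dist ∉ p.realTargets := by decide)
    (he : RealReg.eps ∉ p.realTargets := by decide) : s'.HoldsATSP G ε where
  numVertices := by rw [hf.nat _ hn, h.numVertices]
  dist u v := by rw [hf.real _ hd, h.dist]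
  eps := by rw [hf.real _ he, h.eps]

/-- Computes `ATSP.scale`: the multiples of `ε` are counted until they exceed `9`. -/
def scaleProg : Program :=
  .setVar Reg.scale 0 ;; .setRealVar RealReg.multiple 0 ;;
  .loop (.realLe (.var RealReg.multiple) 9)
    (.setVar Reg.scale (.var Reg.scale + .var Reg.numVertices) ;;
      .setRealVar RealReg.multiple (.var RealReg.multiple + .var RealReg.eps))

theorem haltsWithin_scaleProg (hε : 0 < ε) (hs : s.HoldsATSP G ε) :
    scaleProg.HaltsWithin s (3 * G.scale ε + 3) fun s' => s'.nat Reg.scale 0 0 = G.scale ε := by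
  have floor_le_scale : ((⌊9 / ε⌋₊ + 1 : ℕ) : ℝ) ≤ G.scale ε :=
    Nat.cast_le.2 (Nat.le_mul_of_pos_left _ G.n_pos)
  refine (setVar_seq fun s₁ hf₁ scale_eq₁ => setRealVar_seq fun s₂ hf₂ multiple_eq₂ =>
    loop (N := ⌊9 / ε⌋₊ + 1) (B := 2) (fun k s' => s'.nat Reg.scale 0 0 = G.n * k ∧
      s'.real RealReg.multiple 0 0 = k * ε) ?_ ?_ ?_).mono (by linarith) fun s' _ h => h.1
  · simp [hf₂.nat Reg.scale, scale_eq₁, multiple_eq₂]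
  · rintro k hk s' hf ⟨scale_eq, multiple_eq⟩
    have hs' := ((hs.frame hf₁).frame hf₂).frame hf
    rw [Nat.lt_succ_iff, Nat.le_floor_iff (by positivity), le_div_iff₀ hε] at hk
    refine ⟨by simpa [multiple_eq] using hk, (setVar_seq fun s'' hf' scale_eq' =>
      setReal ⟨?_, ?_⟩).mono (by norm_num) fun _ _ h => h⟩
    · simp [scale_eq', scale_eq, hs'.numVertices]; ring
    · simp [hf'.real RealReg.multiple, multiple_eq, (hs'.frame hf').eps]; ring
  · rintro s' - ⟨-, multiple_eq⟩
    simpa [multiple_eq] using (div_lt_iff₀ hε).1 (Nat.lt_floor_add_one (9 / ε))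

/-- The expression for `ATSP.shifted`. -/
abbrev shiftedExp (u v : NExp) : RExp :=
  .read RealReg.dist u v + .read RealReg.dist 0 u - .read RealReg.dist 0 v

theorem State.HoldsATSP.eval_shiftedExp (hs : s.HoldsATSP G ε) {a b : NExp} {u v : Fin G.n}
    (hu : a.eval s = u) (hv : b.eval s = v) : (shiftedExp a b).eval s = G.shifted u v := by
  have dist_root (v : Fin G.n) : s.real RealReg.dist 0 v = G.d 0 v := hs.dist 0 v
  simp [ATSP.shifted, hu, hv, hs.dist, dist_root]

/-- Computes `ATSP.diam`. -/
def diamProg : Program :=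
  .setRealVar RealReg.diam 0 ;;
  .forLoop Reg.vertex (.var Reg.numVertices)
    (.setRealVar RealReg.shifted (shiftedExp (.var Reg.vertex) 0) ;;
      .ite (.realLe (.var RealReg.shifted) (.var RealReg.diam)) .skip
        (.setRealVar RealReg.diam (.var RealReg.shifted)))

theorem haltsWithin_diamProg (hs : s.HoldsATSP G ε) :
    diamProg.HaltsWithin s (5 * G.n + 3) fun s' => s'.real RealReg.diam 0 0 = G.diam := by
  refine (setRealVar_seq fun s₁ hf₁ diam_eq => forLoop (B := 1 + (1 + 1)) G.n (fun k s' =>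
    (∀ u : Fin G.n, u < k → G.shifted u 0 ≤ s'.real RealReg.diam 0 0) ∧
      s'.real RealReg.diam 0 0 ≤ G.diam) (by decide) ?_ ?_ ?_ ?_).mono (by linarith)
    fun s' _ h => le_antisymm h.2 (Finset.sup'_le _ _ fun u _ => h.1 u u.2)
  · exact fun s' hf => ((hs.frame hf₁).frame hf).numVertices
  · exact fun _ _ _ h => h
  · simpa [diam_eq] using G.diam_nonneg
  · rintro k s' hf hk ⟨le_diam, diam_le⟩
    refine setRealVar_seq fun s'' hf' shifted_eq => (ite (Q := fun t => t.real RealReg.diam 0 0 =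
      max (s''.real RealReg.diam 0 0) (s''.real RealReg.shifted 0 0)) (fun hle => skip ?_)
      fun hlt => setReal ?_).mono le_rfl fun t _ diam_eq => ?_
    · exact (max_eq_left hle).symm
    · simpa using (le_of_not_ge hlt)
    rw [((hs.frame hf₁).frame hf).eval_shiftedExp (a := .var Reg.vertex) (b := 0) hk
      (Fin.val_zero G.n).symm] at shifted_eq
    rw [hf'.real RealReg.diam, shifted_eq] at diam_eq
    rw [diam_eq]
    refine ⟨fun u hu => ?_, max_le diam_le (G.shifted_le_diam k 0)⟩
    rcases Nat.lt_succ_iff_lt_or_eq.1 hu with hu | hu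
    · exact le_max_of_le_left (le_diam u hu)
    · exact Fin.ext hu ▸ le_max_right _ _

theorem ceil_eq_ite_of_le_add_one {x y : ℝ} (hx : 0 ≤ x) (hxy : x ≤ y) (hyx : y ≤ x + 1) :
    ⌈y⌉₊ = if y ≤ ⌈x⌉₊ then ⌈x⌉₊ else ⌈x⌉₊ + 1 := by
  split_ifs with h
  · exact (Nat.ceil_le.2 h).antisymm (Nat.ceil_mono hxy)
  · exact ((Nat.ceil_mono hyx).trans (Nat.ceil_add_one hx).le).antisymm
      (Nat.succ_le_of_lt (Nat.lt_ceil.2 (not_le.1 h)))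

theorem ceil_succ_mul_div (k : ℕ) {a D : ℝ} (ha : 0 ≤ a) (haD : a ≤ D) :
    ⌈(k + 1) * a / D⌉₊ = if (k + 1) * a ≤ ⌈k * a / D⌉₊ * D then ⌈k * a / D⌉₊
      else ⌈k * a / D⌉₊ + 1 := by
  rcases (ha.trans haD).eq_or_lt with rfl | hD
  · simp [haD.antisymm ha]
  · have step_le : (k + 1) * a / D ≤ k * a / D + 1 := by
      rw [add_one_mul, add_div]
      linarith [(div_le_one hD).2 haD]
    simp only [← div_le_iff₀ hD]
    exact ceil_eq_ite_of_le_add_one (by positivity) (by gcongr; linarith) step_le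

/-- The memory contains `k * a` and its quotient by `D`, rounded up, together with the multiple of
`D` for which the quotient stands. -/
structure State.HoldsQuotient (s : State) (a D : ℝ) (k : ℕ) : Prop where
  ceil : s.nat Reg.ceil 0 0 = ⌈k * a / D⌉₊
  threshold : s.real RealReg.threshold 0 0 = ⌈k * a / D⌉₊ * D
  multiple : s.real RealReg.multiple 0 0 = k * a

/-- Adds the shifted weight once to the numerator and updates the quotient. -/
def quotientStepProg : Program :=
  .setRealVar RealReg.multiple (.var RealReg.multiple + .var RealReg.shifted) ;;
  .ite (.realLe (.var RealReg.multiple) (.var RealReg.threshold)) .skip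
    (.setVar Reg.ceil (.var Reg.ceil + 1) ;;
      .setRealVar RealReg.threshold (.var RealReg.threshold + .var RealReg.diam))

theorem haltsWithin_quotientStepProg {a D : ℝ} {k : ℕ} (ha : 0 ≤ a) (haD : a ≤ D)
    (hD : s.real RealReg.diam 0 0 = D) (hshifted : s.real RealReg.shifted 0 0 = a)
    (hs : s.HoldsQuotient a D k) :
    quotientStepProg.HaltsWithin s 4 fun s' => s'.HoldsQuotient a D (k + 1) := by
  refine (setRealVar_seq (B := 1 + 1 + 1) fun s₁ hf₁ multiple_eq => ?_).mono (by norm_num)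
    fun _ _ h => h
  replace multiple_eq : s₁.real RealReg.multiple 0 0 = (k + 1 : ℕ) * a := by
    simp [multiple_eq, hs.multiple, hshifted]
    ring
  have threshold_eq : s₁.real RealReg.threshold 0 0 = ⌈k * a / D⌉₊ * D := by
    rw [hf₁.real RealReg.threshold, hs.threshold]
  have ceil_eq : s₁.nat Reg.ceil 0 0 = ⌈k * a / D⌉₊ := by rw [hf₁.nat Reg.ceil, hs.ceil]
  have ceil_succ := ceil_succ_mul_div k ha haD
  rw [← Nat.cast_add_one] at ceil_succ
  have le_iff : (Test.realLe (.var RealReg.multiple) (.var RealReg.threshold)).eval s₁ ↔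
      (k + 1 : ℕ) * a ≤ ⌈k * a / D⌉₊ * D := by
    simp only [Test.eval_realLe, RExp.eval_read, NExp.eval_ofNat, multiple_eq, threshold_eq]
  refine ite (fun hle => (skip ?_).mono (by norm_num) fun _ _ h => h)
    fun hlt => setVar_seq fun s₂ hf₂ ceil_eq' => setReal ?_
  · rw [if_pos (le_iff.1 hle)] at ceil_succ
    exact ⟨by rw [ceil_succ, ceil_eq], by rw [ceil_succ, threshold_eq], multiple_eq⟩
  · rw [if_neg (mt le_iff.2 hlt)] at ceil_succ
    refine ⟨?_, ?_, ?_⟩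
    · rw [ceil_succ]
      simp [ceil_eq', ceil_eq]
    · rw [ceil_succ]
      simp [hf₂.real RealReg.threshold, threshold_eq, hf₂.real RealReg.diam,
        hf₁.real RealReg.diam, hD, add_one_mul]
    · simp [hf₂.real RealReg.multiple, multiple_eq]

/-- Division is not available: the quotient is counted up while the numerator grows in steps of at
most the denominator. -/
def quotientProg : Program :=
  .setVar Reg.ceil 0 ;; .setRealVar RealReg.threshold 0 ;; .setRealVar RealReg.multiple 0 ;;
  .forLoop Reg.counter (.var Reg.scale) quotientStepProg

theorem haltsWithin_quotientProg {P : ℕ} {a D : ℝ} (ha : 0 ≤ a) (haD : a ≤ D)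
    (hP : s.nat Reg.scale 0 0 = P) (hD : s.real RealReg.diam 0 0 = D)
    (hshifted : s.real RealReg.shifted 0 0 = a) :
    quotientProg.HaltsWithin s (6 * P + 5) fun s' => s'.nat Reg.ceil 0 0 = ⌈P * a / D⌉₊ := by
  refine (setVar_seq fun s₁ hf₁ ceil_eq => setRealVar_seq fun s₂ hf₂ threshold_eq =>
    setRealVar_seq fun s₃ hf₃ multiple_eq => forLoop P (fun k s' => s'.HoldsQuotient a D k)
      (by decide) ?_ ?_ ?_ fun k s' hf _ h => haltsWithin_quotientStepProg ha haD ?_ ?_ h).mono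
    (by linarith) fun s' _ h => h.ceil
  · intro s' hf
    simpa [hf.nat Reg.scale, hf₃.nat Reg.scale, hf₂.nat Reg.scale, hf₁.nat Reg.scale] using hP
  · exact fun k v s' h => ⟨h.ceil, h.threshold, h.multiple⟩
  · constructor
    · simp [hf₃.nat Reg.ceil, hf₂.nat Reg.ceil, ceil_eq]
    · simp [hf₃.real RealReg.threshold, threshold_eq]
    · simp [multiple_eq]
  · rw [hf.real RealReg.diam, hf₃.real RealReg.diam, hf₂.real RealReg.diam, hf₁.real RealReg.diam,
      hD]
  · rw [hf.real RealReg.shifted, hf₃.real RealReg.shifted, hf₂.real RealReg.shifted,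
      hf₁.real RealReg.shifted, hshifted]

/-- Computes the table `ATSP.weight`. -/
def weightProg : Program :=
  .forLoop Reg.vertex (.var Reg.numVertices)
    (.forLoop Reg.target (.var Reg.numVertices)
      (.setRealVar RealReg.shifted (shiftedExp (.var Reg.vertex) (.var Reg.target)) ;;
        quotientProg ;;
        .setNat Reg.weight (.var Reg.vertex) (.var Reg.target) (.var Reg.ceil)))

theorem haltsWithin_weightProg (hs : s.HoldsATSP G ε)
    (hscale : s.nat Reg.scale 0 0 = G.scale ε) (hdiam : s.real RealReg.diam 0 0 = G.diam) :
    weightProg.HaltsWithin s (G.n * (G.n * (6 * G.scale ε + 9) + 4) + 2) fun s' =>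
      ∀ u v : Fin G.n, s'.nat Reg.weight u v = G.weight ε u v := by
  refine (forLoop (B := G.n * (6 * G.scale ε + 9) + 2) G.n (fun k s' => ∀ u v : Fin G.n, u < k →
    s'.nat Reg.weight u v = G.weight ε u v) (by decide) ?_ ?_ (by simp)
    fun u s₁ hf₁ hu rows_lt => ?_).mono (by linarith) fun s' _ h u v => h u v u.2
  · exact fun s' hf => (hs.frame hf).numVertices
  · exact fun _ _ _ h => h
  refine (forLoop (B := 1 + (6 * G.scale ε + 5 + 1)) G.n (fun k s' => ∀ u' v : Fin G.n,
    u' < u ∨ u' = u ∧ v < k → s'.nat Reg.weight u' v = G.weight ε u' v) (by decide)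
    ?_ ?_ (by simpa using rows_lt) fun v s₂ hf₂ hv cells_lt => ?_).mono (by linarith)
    fun s' _ h u' v hu' => h u' v (by omega)
  · exact fun s' hf => ((hs.frame hf₁).frame hf).numVertices
  · exact fun _ _ _ h => h
  refine setRealVar_seq fun s₃ hf₃ shifted_eq => seq (haltsWithin_quotientProg
    (G.shifted_nonneg u v) (G.shifted_le_diam u v) ?_ ?_ ?_) fun s₄ hf₄ ceil_eq => setNat ?_
  · rw [hf₃.nat Reg.scale, hf₂.nat Reg.scale, hf₁.nat Reg.scale, hscale]
  · rw [hf₃.real RealReg.diam, hf₂.real RealReg.diam, hf₁.real RealReg.diam, hdiam]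
  · rw [shifted_eq, ((hs.frame hf₁).frame hf₂).eval_shiftedExp (a := .var Reg.vertex)
      (b := .var Reg.target) (u := u) (v := v) ?_ hv]
    exact (congrFun₂ (hf₂.nat Reg.vertex) 0 0).trans hu
  · intro u' v' h
    have vertex_eq : s₄.nat Reg.vertex 0 0 = u := by
      rw [hf₄.nat Reg.vertex, hf₃.nat Reg.vertex, hf₂.nat Reg.vertex, hu]
    have target_eq : s₄.nat Reg.target 0 0 = v := by
      rw [hf₄.nat Reg.target, hf₃.nat Reg.target, hv]
    simp only [NExp.eval_read, NExp.eval_ofNat, State.setNat_nat, vertex_eq, target_eq, ceil_eq,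
      true_and, Fin.val_inj]
    split_ifs with cell
    · rw [cell.1, cell.2, ATSP.weight]
    · rw [hf₄.nat Reg.weight, hf₃.nat Reg.weight]
      exact cells_lt u' v' (by omega)

end Rounding

/-! ### Building the flowshop instance -/

section Table

variable {T : ℕ → ℕ → ℕ} {x m : ℕ} {p : Program} {s s' : State}

/-- The array of processing times contains the table `T` up to, and excluding, entry `m` of row `x`,
in lexicographic order, and zeros elsewhere. -/
def State.HoldsTable (s : State) (T : ℕ → ℕ → ℕ) (x m : ℕ) : Prop :=
  ∀ j k, s.nat Reg.time j k = if j < x ∨ j = x ∧ k < m then T j k else 0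

theorem State.HoldsTable.frame (h : s.HoldsTable T x m) (hf : Frame p s s')
    (hx : Reg.time ∉ p.natTargets := by decide) : s'.HoldsTable T x m := by
  rwa [HoldsTable, hf.nat _ hx]

theorem State.HoldsTable.setNat (h : s.HoldsTable T x m) :
    (s.setNat Reg.time x m (T x m)).HoldsTable T x (m + 1) := by
  intro j k
  rw [State.setNat_nat, h j k]
  by_cases hjk : j = x ∧ k = m
  · simp [hjk.1, hjk.2]
  · rw [if_neg (by simpa using hjk)]
    exact if_congr (by omega) rfl rfl

theorem State.HoldsTable.row_end (h : s.HoldsTable T x m) (hT : ∀ k, m ≤ k → T x k = 0) :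
    s.HoldsTable T (x + 1) 0 := by
  intro j k
  rw [h j k]
  by_cases hjk : j = x ∧ m ≤ k
  · simp [hjk.1, hT k hjk.2]
  · exact if_congr (by omega) rfl rfl

/-- The minimum, by truncated subtraction. -/
abbrev minExp (a b : NExp) : NExp := a - (a - b)

/-- The expression for `wave` at the current scale and coordinate. -/
abbrev waveExp (i : NExp) : NExp :=
  minExp (.var Reg.height) i - minExp (.var Reg.height) (i - .var Reg.scale)

theorem eval_waveExp {P F r : ℕ} (hP : s.nat Reg.scale 0 0 = P) (hF : s.nat Reg.height 0 0 = F)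
    {i : NExp} (hi : i.eval s = r) : (waveExp i).eval s = wave P F r := by
  simp only [NExp.eval_sub, NExp.eval_read, NExp.eval_ofNat, hP, hF, hi, wave]
  omega

/-- Writes the processing times of the current job for one coordinate. -/
def waveProg : Program :=
  .forLoop Reg.phase (.var Reg.scale + .var Reg.scale)
    (.setNat Reg.time (.var Reg.job) (.var Reg.machine)
        (1 + waveExp (.var Reg.phase + 1) - waveExp (.var Reg.phase)) ;;
      .setVar Reg.machine (.var Reg.machine + 1))

theorem haltsWithin_waveProg {P F : ℕ} (hP : s.nat Reg.scale 0 0 = P)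
    (hF : s.nat Reg.height 0 0 = F) (hjob : s.nat Reg.job 0 0 = x)
    (hmachine : s.nat Reg.machine 0 0 = m) (htable : s.HoldsTable T x m)
    (hT : ∀ r < 2 * P, T x (m + r) = 1 + wave P F (r + 1) - wave P F r) :
    waveProg.HaltsWithin s (8 * P + 2) fun s' =>
      s'.nat Reg.machine 0 0 = m + 2 * P ∧ s'.HoldsTable T x (m + 2 * P) := by
  refine (forLoop (B := 1 + 1) (2 * P) (fun k s' => s'.nat Reg.machine 0 0 = m + k ∧
    s'.HoldsTable T x (m + k)) (by decide) ?_ ?_ ⟨hmachine, htable⟩ ?_).mono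
    (by push_cast; linarith) fun _ _ h => h
  · intro s' hf
    simp [hf.nat Reg.scale, hP, two_mul]
  · exact fun _ _ _ h => h
  · rintro r s₁ hf hr ⟨machine_eq, table⟩
    have wave_eq {i : NExp} {k : ℕ} (hi : i.eval s₁ = k) : (waveExp i).eval s₁ = wave P F k :=
      eval_waveExp (by rw [hf.nat Reg.scale, hP]) (by rw [hf.nat Reg.height, hF]) hi
    have time_eq : (1 + waveExp (.var Reg.phase + 1) - waveExp (.var Reg.phase)).eval s₁ =
        T x (m + r) := by
      rw [hT r r.2, NExp.eval_sub, NExp.eval_add, wave_eq (i := .var Reg.phase) hr,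
        wave_eq (i := .var Reg.phase + 1) (k := r + 1) (by simp [hr]), NExp.eval_ofNat]
    have job_eq : (NExp.var Reg.job).eval s₁ = x := by simp [hf.nat Reg.job, hjob]
    refine seq (P := fun s' => s'.nat Reg.machine 0 0 = m + r ∧ s'.HoldsTable T x (m + r + 1))
      (setNat ?_) fun s₂ _ ⟨machine_eq', table'⟩ => setNat ⟨?_, ?_⟩
    · rw [time_eq, job_eq, NExp.eval_read, NExp.eval_ofNat, machine_eq]
      exact ⟨machine_eq, table.setNat⟩
    · simp [machine_eq', add_assoc]
    · exact table'

end Table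

section Build

variable {n P : ℕ} {w : Fin n → Fin n → ℕ} {c : Fin (P * P)} {u : Fin n} {p : Program}
  {s s' : State}

/-- The memory contains the number of vertices, the scale `P` and the weights `w`. -/
structure State.HoldsWeights (s : State) (P : ℕ) (w : Fin n → Fin n → ℕ) : Prop where
  numVertices : s.nat Reg.numVertices 0 0 = n
  scale : s.nat Reg.scale 0 0 = P
  weight (u v : Fin n) : s.nat Reg.weight u v = w u v

theorem State.HoldsWeights.frame (h : s.HoldsWeights P w) (hf : Frame p s s')
    (hn : Reg.numVertices ∉ p.natTargets := by decide)
    (hP : Reg.scale ∉ p.natTargets := by decide)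
    (hw : Reg.weight ∉ p.natTargets := by decide) : s'.HoldsWeights P w where
  numVertices := by rw [hf.nat _ hn, h.numVertices]
  scale := by rw [hf.nat _ hP, h.scale]
  weight u v := by rw [hf.nat _ hw, h.weight]

/-- The current copy is `c`, given together with its digits to the base `P`. -/
structure State.AtCopy (s : State) (c : Fin (P * P)) : Prop where
  copy : s.nat Reg.copy 0 0 = c
  digit₁ : s.nat Reg.digit₁ 0 0 = c.divNat
  digit₂ : s.nat Reg.digit₂ 0 0 = c.modNat

theorem State.AtCopy.frame (h : s.AtCopy c) (hf : Frame p s s')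
    (hc : Reg.copy ∉ p.natTargets := by decide) (h₁ : Reg.digit₁ ∉ p.natTargets := by decide)
    (h₂ : Reg.digit₂ ∉ p.natTargets := by decide) : s'.AtCopy c where
  copy := by rw [hf.nat _ hc, h.copy]
  digit₁ := by rw [hf.nat _ h₁, h.digit₁]
  digit₂ := by rw [hf.nat _ h₂, h.digit₂]

/-- The first `x` jobs are labelled with their copies and their vertices. -/
structure State.HoldsLabels (s : State) (K n x : ℕ) : Prop where
  jobCopy (j : Fin (K * n)) : j < x → s.nat Reg.jobCopy j 0 = j.divNat
  jobVertex (j : Fin (K * n)) : j < x → s.nat Reg.jobVertex j 0 = j.modNat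

/-- Records the copy and the vertex of the current job. -/
def labelProg : Program :=
  .setNat Reg.jobCopy (.var Reg.job) 0 (.var Reg.copy) ;;
  .setNat Reg.jobVertex (.var Reg.job) 0 (.var Reg.vertex)

theorem haltsWithin_labelProg {K : ℕ} {c : Fin K} (hc : s.nat Reg.copy 0 0 = c)
    (hu : s.nat Reg.vertex 0 0 = u) (hjob : s.nat Reg.job 0 0 = Fin.mkDivMod c u)
    (hlabels : s.HoldsLabels K n (Fin.mkDivMod c u)) :
    labelProg.HaltsWithin s 2 fun s' => s'.HoldsLabels K n (Fin.mkDivMod c u + 1) := by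
  refine (seq (P := (· = s.setNat Reg.jobCopy (Fin.mkDivMod c u) 0 c)) (setNat ?_)
    (B' := 1) ?_).mono (by norm_num) fun _ _ h => h
  · simp only [NExp.eval_read, NExp.eval_ofNat, hc, hjob]
  rintro _ - rfl
  refine setNat ⟨fun j hj => ?_, fun j hj => ?_⟩ <;>
    rcases Nat.lt_succ_iff_lt_or_eq.1 hj with hj | hj
  · simpa [-Fin.coe_mkDivMod, hu, hjob, hj.ne] using hlabels.jobCopy j hj
  · simp [Fin.ext hj]
  · simpa [-Fin.coe_mkDivMod, hu, hjob, hj.ne] using hlabels.jobVertex j hj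
  · simp [Fin.ext hj, hu, hjob]

/-- Computes `copyCoord` for the current job and coordinate. -/
def coordProg : Program :=
  .ite (.natLt (.var Reg.coord) (.var Reg.numVertices))
    (.setVar Reg.height (.read Reg.weight (.var Reg.vertex) (.var Reg.coord)))
    (.ite (.or (.natEq (.var Reg.coord) (.var Reg.numVertices + .var Reg.digit₁))
        (.natEq (.var Reg.coord) (.var Reg.numVertices + .var Reg.scale + .var Reg.digit₂)))
      (.setVar Reg.height (.read Reg.weight (.var Reg.vertex) 0))
      (.setVar Reg.height 0))

variable [NeZero n]

theorem haltsWithin_coordProg (hs : s.HoldsWeights P w) (hc : s.AtCopy c)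
    (hu : s.nat Reg.vertex 0 0 = u) {q : ℕ} (hq : s.nat Reg.coord 0 0 = q) :
    coordProg.HaltsWithin s 3 fun s' => s'.nat Reg.height 0 0 = copyCoord w c u q := by
  refine (ite (B := 1 + 1) (fun hlt => (setNat ?_).mono (by norm_num) fun _ _ h => h) fun hle =>
    ite (fun heq => setNat ?_) fun hne => setNat ?_).mono (by norm_num) fun _ _ h => h
  · replace hlt : q < n := by simpa [hq, hs.numVertices, Nat.succ_le_iff] using hlt
    simpa [copyCoord, hlt, hu, hq] using hs.weight u ⟨q, hlt⟩
  all_goals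
    replace hle : ¬ q < n := by simpa [hq, hs.numVertices, Nat.succ_le_iff] using hle
    rw [copyCoord, dif_neg hle]
    simp only [Test.eval_or, Test.eval_natEq, NExp.eval_add, NExp.eval_read, NExp.eval_ofNat, hq,
      hs.numVertices, hs.scale, hc.digit₁, hc.digit₂] at *
  · rw [if_pos heq]
    simpa [hu] using hs.weight u 0
  · exact (if_neg hne).symm

variable [NeZero P]

theorem NWFS.input_time (I : NWFS) {j k : ℕ} (hj : j < I.jobs) (hk : k < I.machines) :
    I.input.nat Reg.time j k = I.time ⟨j, hj⟩ ⟨k, hk⟩ := by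
  simp [NWFS.input, hj, hk]

theorem NWFS.input_time_eq_zero (I : NWFS) {j k : ℕ} (hjk : I.jobs ≤ j ∨ I.machines ≤ k) :
    I.input.nat Reg.time j k = 0 := by
  simp only [NWFS.input]
  simp
  omega

theorem input_copies_time (hw : IsRootedSemimetric P w) (c : Fin (P * P)) (u : Fin n) {q r : ℕ}
    (hq : q < n + 2 * P) (hr : r < 2 * P) :
    (NWFS.copies P w).input.nat Reg.time (Fin.mkDivMod c u) (q * (2 * P) + r) =
      1 + wave P (copyCoord w c u q) (r + 1) - wave P (copyCoord w c u q) r := by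
  have machine_lt : q * (2 * P) + r < (n + 2 * P) * (2 * P) := by
    calc q * (2 * P) + r < (q + 1) * (2 * P) := by rw [add_mul]; omega
      _ ≤ (n + 2 * P) * (2 * P) := Nat.mul_le_mul_right _ hq
  rw [NWFS.input_time _ (Fin.mkDivMod c u).2 machine_lt]
  change 1 + waveTrain P _ (q * (2 * P) + r + 1) - waveTrain P _ (q * (2 * P) + r) = _
  obtain ⟨div_eq, mod_eq⟩ := (Nat.div_mod_unique (a := q * (2 * P) + r) (c := r) (d := q)
    (by omega)).2 ⟨by ring, hr⟩
  rw [waveTrain_succ (copyCoord_le hw _ _) (Nat.pos_of_neZero P), div_eq, mod_eq,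
    waveTrain_mul_add _ _ hr]
  simp only [Fin.eta, Fin.divNat_mkDivMod, Fin.modNat_mkDivMod]

/-- Writes the processing times of the current job. -/
def rowProg : Program :=
  .setVar Reg.machine 0 ;;
  .forLoop Reg.coord (.var Reg.numVertices + .var Reg.scale + .var Reg.scale)
    (coordProg ;; waveProg)

theorem haltsWithin_rowProg (hw : IsRootedSemimetric P w) (hs : s.HoldsWeights P w)
    (hc : s.AtCopy c) (hu : s.nat Reg.vertex 0 0 = u)
    (hjob : s.nat Reg.job 0 0 = Fin.mkDivMod c u)
    (htable : s.HoldsTable ((NWFS.copies P w).input.nat Reg.time) (Fin.mkDivMod c u) 0) :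
    rowProg.HaltsWithin s ((n + 2 * P) * (8 * P + 7) + 3) fun s' =>
      s'.nat Reg.machine 0 0 = (n + 2 * P) * (2 * P) ∧
      s'.HoldsTable ((NWFS.copies P w).input.nat Reg.time) (Fin.mkDivMod c u + 1) 0 := by
  refine (setVar_seq fun s₁ hf₁ machine_eq₁ => forLoop (B := 3 + (8 * P + 2)) (n + 2 * P)
    (fun k s' => s'.nat Reg.machine 0 0 = k * (2 * P) ∧
      s'.HoldsTable ((NWFS.copies P w).input.nat Reg.time) (Fin.mkDivMod c u) (k * (2 * P)))
    (by decide) ?_ ?_ ?_ ?_).mono (by push_cast; linarith) fun s' _ ⟨machine_eq, table⟩ =>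
      ⟨machine_eq, table.row_end fun k hk => NWFS.input_time_eq_zero _ (.inr hk)⟩
  · intro s' hf
    have hs' := (hs.frame hf₁).frame hf
    simp [hs'.numVertices, hs'.scale, add_assoc, two_mul]
  · exact fun _ _ _ h => h
  · simpa [machine_eq₁] using htable.frame hf₁
  · rintro q s' hf hq ⟨machine_eq, table⟩
    have vertex_eq : s'.nat Reg.vertex 0 0 = u := by
      rw [hf.nat Reg.vertex, hf₁.nat Reg.vertex, hu]
    refine seq (haltsWithin_coordProg ((hs.frame hf₁).frame hf) ((hc.frame hf₁).frame hf)
      vertex_eq hq) fun s'' hf' height_eq => ?_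
    rw [Nat.succ_mul]
    refine haltsWithin_waveProg ?_ height_eq ?_ ?_ (table.frame hf') fun r hr =>
      input_copies_time hw c u q.2 hr
    · rw [hf'.nat Reg.scale, ((hs.frame hf₁).frame hf).scale]
    · rw [hf'.nat Reg.job, hf.nat Reg.job, hf₁.nat Reg.job, hjob]
    · rw [hf'.nat Reg.machine, machine_eq]

/-- The first `x` jobs are in the memory. -/
structure State.HoldsJobs (s : State) (P : ℕ) [NeZero P] (w : Fin n → Fin n → ℕ) (x : ℕ) : Prop
    where
  job : s.nat Reg.job 0 0 = x
  labels : s.HoldsLabels (P * P) n x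
  machine : 0 < x → s.nat Reg.machine 0 0 = (n + 2 * P) * (2 * P)
  table : s.HoldsTable ((NWFS.copies P w).input.nat Reg.time) x 0

/-- Constructs the current job. -/
def jobProg : Program := labelProg ;; rowProg ;; .setVar Reg.job (.var Reg.job + 1)

theorem haltsWithin_jobProg (hw : IsRootedSemimetric P w) (hs : s.HoldsWeights P w)
    (hc : s.AtCopy c) (hu : s.nat Reg.vertex 0 0 = u)
    (hjobs : s.HoldsJobs P w (Fin.mkDivMod c u)) :
    jobProg.HaltsWithin s ((n + 2 * P) * (8 * P + 7) + 6) fun s' =>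
      s'.HoldsJobs P w (Fin.mkDivMod c u + 1) := by
  refine (seq (haltsWithin_labelProg hc.copy hu hjobs.job hjobs.labels) fun s₁ hf₁ labels =>
    seq (haltsWithin_rowProg hw (hs.frame hf₁) (hc.frame hf₁) ?_ ?_ (hjobs.table.frame hf₁))
      fun s₂ hf₂ ⟨machine_eq, table⟩ => setNat ⟨?_, ⟨?_, ?_⟩, fun _ => machine_eq, table⟩).mono
    (by linarith) fun _ _ h => h
  · rw [hf₁.nat Reg.vertex, hu]
  · rw [hf₁.nat Reg.job, hjobs.job]
  · simp [hf₂.nat Reg.job, hf₁.nat Reg.job, hjobs.job]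
  · simpa [hf₂.nat Reg.jobCopy] using labels.jobCopy
  · simpa [hf₂.nat Reg.jobVertex] using labels.jobVertex

/-- Constructs the jobs of the current copy. -/
def copyProg : Program := .forLoop Reg.vertex (.var Reg.numVertices) jobProg

theorem haltsWithin_copyProg (hw : IsRootedSemimetric P w) (hs : s.HoldsWeights P w)
    (hc : s.AtCopy c) (hjobs : s.HoldsJobs P w (n * c)) :
    copyProg.HaltsWithin s (n * ((n + 2 * P) * (8 * P + 7) + 8) + 2) fun s' =>
      s'.HoldsJobs P w (n * (c + 1)) := by
  refine (forLoop (B := (n + 2 * P) * (8 * P + 7) + 6) n (fun k s' => s'.HoldsJobs P w (n * c + k))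
    (by decide) ?_ ?_ hjobs fun u s' hf hu h =>
      haltsWithin_jobProg hw (hs.frame hf) (hc.frame hf) hu h).mono (by linarith) fun _ _ h => h
  · exact fun s' hf => (hs.frame hf).numVertices
  · exact fun k v s' h => ⟨h.job, ⟨h.labels.jobCopy, h.labels.jobVertex⟩, h.machine, h.table⟩

/-- Constructs the jobs of all copies, by a loop over the two digits of the copy. -/
def jobsProg : Program :=
  .setVar Reg.job 0 ;; .setVar Reg.copy 0 ;;
  .forLoop Reg.digit₁ (.var Reg.scale)
    (.forLoop Reg.digit₂ (.var Reg.scale) (copyProg ;; .setVar Reg.copy (.var Reg.copy + 1)))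

theorem haltsWithin_jobsProg (hw : IsRootedSemimetric P w) (hs : s.HoldsWeights P w)
    (htime : ∀ j k, s.nat Reg.time j k = 0) :
    jobsProg.HaltsWithin s (P * (P * (n * ((n + 2 * P) * (8 * P + 7) + 8) + 5) + 4) + 4) fun s' =>
      s'.nat Reg.copy 0 0 = P * P ∧ s'.HoldsJobs P w (P * P * n) := by
  refine (setVar_seq fun s₁ hf₁ job_eq => setVar_seq fun s₂ hf₂ copy_eq => forLoop
    (B := P * (n * ((n + 2 * P) * (8 * P + 7) + 8) + 5) + 2) P
    (fun a s' => s'.nat Reg.copy 0 0 = P * a ∧ s'.HoldsJobs P w (n * (P * a)))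
    (by decide) ?_ ?_ ?_ fun a s₃ hf₃ ha h₃ => ?_).mono (by linarith)
    fun s' _ h => ⟨h.1, mul_comm n _ ▸ h.2⟩
  · exact fun s' hf => (((hs.frame hf₁).frame hf₂).frame hf).scale
  · exact fun k v s' ⟨h, h'⟩ => ⟨h, h'.job,
      ⟨h'.labels.jobCopy, h'.labels.jobVertex⟩, h'.machine, h'.table⟩
  · refine ⟨copy_eq, by simpa [hf₂.nat Reg.job] using job_eq, ⟨by simp, by simp⟩, by simp, ?_⟩
    intro j k
    simp [hf₂.nat Reg.time, hf₁.nat Reg.time, htime]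
  refine (forLoop (B := n * ((n + 2 * P) * (8 * P + 7) + 8) + 2 + 1) P
    (fun b s' => s'.nat Reg.copy 0 0 = P * a + b ∧ s'.HoldsJobs P w (n * (P * a + b)))
    (by decide) ?_ ?_ h₃ fun b s₄ hf₄ hb ⟨copy_eq', jobs⟩ => ?_).mono (by linarith) fun _ _ h => h
  · exact fun s' hf => ((((hs.frame hf₁).frame hf₂).frame hf₃).frame hf).scale
  · exact fun k v s' ⟨h, h'⟩ => ⟨h, h'.job,
      ⟨h'.labels.jobCopy, h'.labels.jobVertex⟩, h'.machine, h'.table⟩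
  have atCopy : s₄.AtCopy (Fin.mkDivMod a b) := by
    refine ⟨copy_eq', ?_, ?_⟩
    · rw [Fin.divNat_mkDivMod, hf₄.nat Reg.digit₁, ha]
    · rw [Fin.modNat_mkDivMod, hb]
  refine seq (haltsWithin_copyProg hw ((((hs.frame hf₁).frame hf₂).frame hf₃).frame hf₄) atCopy
    jobs) fun s₅ hf₅ jobs' => setNat ⟨?_, ?_⟩
  · simp [hf₅.nat Reg.copy, copy_eq', add_assoc]
  · exact ⟨jobs'.job, ⟨jobs'.labels.jobCopy, jobs'.labels.jobVertex⟩, jobs'.machine, jobs'.table⟩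

end Build

section Reduction

variable {G : ATSP} {ε : ℝ} {s : State}

/-- The memory contains `G` and `ε`, the number of copies and of jobs of the flowshop instance that
is constructed from them, and the copies and vertices for which its jobs stand; the counters
`Reg.filled` have not been used. -/
structure State.HoldsReduction (s : State) (G : ATSP) (ε : ℝ) : Prop where
  atsp : s.HoldsATSP G ε
  copy : s.nat Reg.copy 0 0 = G.scale ε * G.scale ε
  job : s.nat Reg.job 0 0 = G.scale ε * G.scale ε * G.n
  labels : s.HoldsLabels (G.scale ε * G.scale ε) G.n (G.scale ε * G.scale ε * G.n)
  filled : s.nat Reg.filled = 0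

theorem State.HoldsReduction.frame {p : Program} {s' : State} (h : s.HoldsReduction G ε)
    (hf : Frame p s s')
    (hn : ∀ x ∈ [Reg.numVertices, Reg.job, Reg.copy, Reg.jobCopy, Reg.jobVertex, Reg.filled],
      x ∉ p.natTargets)
    (hr : ∀ x ∈ [RealReg.dist, RealReg.eps], x ∉ p.realTargets) : s'.HoldsReduction G ε where
  atsp := h.atsp.frame hf (hn _ (by simp)) (hr _ (by simp)) (hr _ (by simp))
  copy := by rw [hf.nat _ (hn _ (by simp)), h.copy]
  job := by rw [hf.nat _ (hn _ (by simp)), h.job]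
  labels := ⟨hf.nat Reg.jobCopy (hn _ (by simp)) ▸ h.labels.jobCopy,
    hf.nat Reg.jobVertex (hn _ (by simp)) ▸ h.labels.jobVertex⟩
  filled := by rw [hf.nat _ (hn _ (by simp)), h.filled]

/-- Stores the numbers of jobs and machines where the output convention expects them. -/
def dimensionsProg : Program :=
  .setVar Reg.numJobs (.var Reg.job) ;; .setVar Reg.numMachines (.var Reg.machine)

theorem haltsWithin_dimensionsProg (hs : s.HoldsATSP G ε)
    (hcopy : s.nat Reg.copy 0 0 = G.scale ε * G.scale ε)
    (hjobs : s.HoldsJobs (G.scale ε) (G.weight ε) (G.scale ε * G.scale ε * G.n))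
    (hzero : ∀ x ∈ [Reg.numJobs, Reg.numMachines, Reg.filled], s.nat x = 0) :
    dimensionsProg.HaltsWithin s 2 fun s' => s'.HoldsReduction G ε ∧
      ∀ x ∈ [Reg.numJobs, Reg.numMachines, Reg.time],
        s'.nat x = (G.toNWFS ε).input.nat x := by
  have machine_eq := hjobs.machine (G.toNWFS ε).jobs_pos
  have time_eq : s.nat Reg.time = (G.toNWFS ε).input.nat Reg.time := by
    ext j k
    rw [hjobs.table j k, ite_eq_left_iff]
    exact fun h => (NWFS.input_time_eq_zero _ (.inl (not_lt.1 fun hj => h (.inl hj)))).symm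
  refine (seq (B' := 1) (P := (· = s.setNat Reg.numJobs 0 0 (G.scale ε * G.scale ε * G.n)))
    (setNat ?_) ?_).mono (by norm_num) fun _ _ h => h
  · simp [hjobs.job]
  rintro _ - rfl
  refine setNat ⟨⟨⟨hs.numVertices, hs.dist, hs.eps⟩, hcopy, hjobs.job,
    ⟨hjobs.labels.jobCopy, hjobs.labels.jobVertex⟩, hzero Reg.filled (by simp)⟩, fun x hx => ?_⟩
  simp only [List.mem_cons, List.not_mem_nil, or_false] at hx
  rcases hx with rfl | rfl | rfl
  · ext i j
    simp [NWFS.input, hzero Reg.numJobs]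
  · ext i j
    simp [NWFS.input, hzero Reg.numMachines, machine_eq]
  · ext i j
    simp [time_eq]

/-- The first algorithm of the theorem: constructs the flowshop instance. -/
def buildProg : Program := scaleProg ;; diamProg ;; weightProg ;; jobsProg ;; dimensionsProg

theorem build_time_le {n P : ℝ} (hn : 0 ≤ n) (hnP : n ≤ P) (hP : 1 ≤ P) :
    3 * P + 3 + (5 * n + 3 + (n * (n * (6 * P + 9) + 4) + 2 +
      (P * (P * (n * ((n + 2 * P) * (8 * P + 7) + 8) + 5) + 4) + 4 + 2))) ≤ 103 * P ^ 5 := by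
  calc _ ≤ 3 * P + 3 + (5 * P + 3 + (P * (P * (6 * P + 9) + 4) + 2 +
      (P * (P * (P * ((P + 2 * P) * (8 * P + 7) + 8) + 5) + 4) + 4 + 2))) := by gcongr
    _ = 24 * P ^ 5 + 21 * P ^ 4 + 14 * P ^ 3 + 14 * P ^ 2 + 16 * P ^ 1 + 14 * P ^ 0 := by ring
    _ ≤ 24 * P ^ 5 + 21 * P ^ 5 + 14 * P ^ 5 + 14 * P ^ 5 + 16 * P ^ 5 + 14 * P ^ 5 := by
      gcongr <;> norm_num
    _ = 103 * P ^ 5 := by ring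

theorem haltsWithin_buildProg (hε : 0 < ε) (hs : s.HoldsATSP G ε)
    (hzero : ∀ x ∈ [Reg.numJobs, Reg.numMachines, Reg.time, Reg.filled], s.nat x = 0) :
    buildProg.HaltsWithin s (103 * (G.scale ε : ℝ) ^ 5) fun s' => s'.HoldsReduction G ε ∧
      ∀ x ∈ [Reg.numJobs, Reg.numMachines, Reg.time],
        s'.nat x = (G.toNWFS ε).input.nat x := by
  refine (seq (haltsWithin_scaleProg hε hs) fun s₁ hf₁ scale_eq =>
    seq (haltsWithin_diamProg (hs.frame hf₁)) fun s₂ hf₂ diam_eq =>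
    seq (haltsWithin_weightProg ((hs.frame hf₁).frame hf₂) ?_ diam_eq) fun s₃ hf₃ weight_eq =>
    seq (haltsWithin_jobsProg (G.isRootedSemimetric_weight ε) ⟨?_, ?_, weight_eq⟩ ?_)
    fun s₄ hf₄ ⟨copy_eq, jobs⟩ => haltsWithin_dimensionsProg
      ((((hs.frame hf₁).frame hf₂).frame hf₃).frame hf₄) copy_eq jobs ?_).mono
    (build_time_le (Nat.cast_nonneg _) (Nat.cast_le.2 G.n_le_scale) ?_) fun _ _ h => h
  · rw [hf₂.nat Reg.scale, scale_eq]
  · exact (((hs.frame hf₁).frame hf₂).frame hf₃).numVertices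
  · rw [hf₃.nat Reg.scale, hf₂.nat Reg.scale, scale_eq]
  · intro j k
    rw [hf₃.nat Reg.time, hf₂.nat Reg.time, hf₁.nat Reg.time, hzero Reg.time (by simp)]
    rfl
  · intro x hx
    rw [← hzero x (by simp at hx ⊢; omega)]
    simp only [List.mem_cons, List.not_mem_nil, or_false] at hx
    rcases hx with rfl | rfl | rfl
    all_goals rw [hf₄.nat _, hf₃.nat _, hf₂.nat _, hf₁.nat _]
  · exact Nat.one_le_cast.2 (Nat.pos_of_neZero _)

end Reduction

/-! ### Extracting the best tour -/

section Split

variable {K n : ℕ} {σ : Equiv.Perm (Fin (K * n))} {s : State}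

/-- The first `k` jobs of the order `σ` are distributed among the tours of the copies. -/
structure State.HoldsSplit (s : State) (σ : Equiv.Perm (Fin (K * n))) (k : ℕ) : Prop where
  filled (c : Fin K) : s.nat Reg.filled c 0 = copyRank σ c k
  order (k' : Fin (K * n)) : k' < k →
    s.nat Reg.order (copyPosition σ k').1 (copyPosition σ k').2 = (σ k').modNat

/-- The job at the current position of the schedule. -/
abbrev currentJob : NExp := .read Reg.schedule (.var Reg.counter) 0

/-- The copy to which the current job belongs. -/
abbrev currentCopy : NExp := .read Reg.jobCopy currentJob 0

/-- The number of jobs of the current copy that come earlier in the schedule. -/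
abbrev currentRank : NExp := .read Reg.filled currentCopy 0

/-- Appends the vertex of the current job to the tour of its copy. -/
def splitStepProg : Program :=
  .setNat Reg.order currentCopy currentRank (.read Reg.jobVertex currentJob 0) ;;
  .setNat Reg.filled currentCopy 0 (currentRank + 1)

theorem haltsWithin_splitStepProg (hσ : s.HoldsSchedule σ) (hlabels : s.HoldsLabels K n (K * n))
    {k : Fin (K * n)} (hk : s.nat Reg.counter 0 0 = k) (hsplit : s.HoldsSplit σ k) :
    splitStepProg.HaltsWithin s (1 + 1) fun s' => s'.HoldsSplit σ (k + 1) := by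
  have job_eq : currentJob.eval s = σ k := by simpa [hk] using hσ k
  have copy_eq : currentCopy.eval s = (σ k).divNat := by
    rw [NExp.eval_read, job_eq]
    exact hlabels.jobCopy _ (σ k).2
  have rank_eq : currentRank.eval s = copyRank σ (σ k).divNat k := by
    rw [NExp.eval_read, copy_eq]
    exact hsplit.filled _
  refine seq (P := (· = s.setNat Reg.order (copyPosition σ k).1 (copyPosition σ k).2
    (σ k).modNat)) (setNat ?_) ?_
  · rw [copy_eq, rank_eq, copyPosition_fst, copyPosition_snd, NExp.eval_read, job_eq,
      NExp.eval_ofNat, hlabels.jobVertex _ (σ k).2]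
  rintro _ - rfl
  have copy_eq' : currentCopy.eval (s.setNat Reg.order (copyPosition σ k).1
      (copyPosition σ k).2 (σ k).modNat) = (σ k).divNat := by simpa using copy_eq
  refine setNat ⟨fun c => ?_, fun k' hk' => ?_⟩
  · simp only [copy_eq', NExp.eval_add, NExp.eval_read, NExp.eval_ofNat, State.setNat_nat,
      hsplit.filled, Fin.val_inj, true_and, and_true]
    by_cases hc : c = (σ k).divNat
    · simp [hc, copyRank_succ]
    · simp [hc, copyRank_succ_of_ne σ hc]
  · rcases Nat.lt_succ_iff_lt_or_eq.1 hk' with hk' | hk'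
    · have cell_ne : copyPosition σ k' ≠ copyPosition σ k :=
        (copyPosition σ).injective.ne (Fin.ne_of_lt hk')
      simpa [Fin.val_inj, ← Prod.ext_iff, cell_ne] using hsplit.order k' hk'
    · simp [Fin.ext hk']

/-- Splits the schedule into the vertex orders of the copies. -/
def splitProg : Program := .forLoop Reg.counter (.var Reg.job) splitStepProg

theorem haltsWithin_splitProg (hσ : s.HoldsSchedule σ) (hjob : s.nat Reg.job 0 0 = K * n)
    (hlabels : s.HoldsLabels K n (K * n)) (hfilled : s.nat Reg.filled = 0) :
    splitProg.HaltsWithin s (K * n * 4 + 2) fun s' =>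
      ∀ c i, s'.nat Reg.order (c : Fin K) (i : Fin n) = copyTour σ c i := by
  refine (forLoop (B := 1 + 1) (K * n) (fun k s' => s'.HoldsSplit σ k) (by decide) ?_ ?_ ?_ ?_).mono
    (by push_cast; linarith) fun s' _ hsplit c i => ?_
  · intro s' hf
    simp [hf.nat Reg.job, hjob]
  · exact fun k v s' h => ⟨h.filled, h.order⟩
  · exact ⟨by simp [hfilled, copyRank_zero], by simp⟩
  · refine fun k s' hf hk hsplit => haltsWithin_splitStepProg ?_ ?_ hk hsplit
    · simpa only [State.HoldsSchedule, hf.nat Reg.schedule] using hσ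
    · exact ⟨hf.nat Reg.jobCopy ▸ hlabels.jobCopy, hf.nat Reg.jobVertex ▸ hlabels.jobVertex⟩
  · have := hsplit.order ((copyPosition σ).symm (c, i)) (Fin.is_lt _)
    simpa [← copyTour_copyPosition] using this

end Split

section Select

variable {G : ATSP} {ε : ℝ} {K : ℕ} {τ : Fin K → Equiv.Perm (Fin G.n)} {s : State}

theorem val_finRotate {n : ℕ} (k : Fin n) :
    (finRotate n k : ℕ) = if (k : ℕ) + 1 < n then (k : ℕ) + 1 else 0 := by
  obtain _ | n := n
  · exact k.elim0
  · rw [coe_finRotate, ← ite_not]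
    exact if_congr (by simp [Fin.ext_iff, Fin.val_last]; omega) rfl rfl

/-- The `i`-th vertex of the current candidate tour. -/
abbrev candidateVertex (i : NExp) : NExp := .read Reg.order (.var Reg.candidate) i

/-- Computes the length of the current candidate tour. -/
def lengthProg : Program :=
  .setRealVar RealReg.length 0 ;;
  .forLoop Reg.counter (.var Reg.numVertices)
    (.ite (.natLt (.var Reg.counter + 1) (.var Reg.numVertices))
        (.setVar Reg.next (.var Reg.counter + 1)) (.setVar Reg.next 0) ;;
      .setRealVar RealReg.length (.var RealReg.length + .read RealReg.dist
        (candidateVertex (.var Reg.counter)) (candidateVertex (.var Reg.next))))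

theorem haltsWithin_lengthProg {τ : Equiv.Perm (Fin G.n)} (hs : s.HoldsATSP G ε)
    (hτ : ∀ i : Fin G.n, s.nat Reg.order (s.nat Reg.candidate 0 0) i = τ i) :
    lengthProg.HaltsWithin s (5 * G.n + 3) fun s' =>
      s'.real RealReg.length 0 0 = G.tourLength τ := by
  let arc (i : Fin G.n) : ℝ := G.d (τ i) (τ (finRotate G.n i))
  refine (setRealVar_seq fun s₁ hf₁ length_eq₁ => forLoop (B := 1 + 1 + 1) G.n (fun k s' =>
    s'.real RealReg.length 0 0 = ∑ i ∈ Finset.range k, arc (Fin.ofNat G.n i))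
    (by decide) ?_ ?_ ?_ fun k s₂ hf₂ counter_eq length_eq₂ => ?_).mono (by linarith)
    fun s' _ h => by simpa [Finset.sum_range, arc, ATSP.tourLength] using h
  · exact fun s' hf => ((hs.frame hf₁).frame hf).numVertices
  · exact fun _ _ _ h => h
  · simp [length_eq₁]
  have hs₂ := (hs.frame hf₁).frame hf₂
  refine seq (P := fun s' => s'.nat Reg.next 0 0 = finRotate G.n k) (ite (fun hlt => setNat ?_)
    fun hle => setNat ?_) fun s₃ hf₃ next_eq => setReal ?_
  · rw [val_finRotate, if_pos (by simpa [counter_eq, hs₂.numVertices] using hlt)]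
    simp [counter_eq]
  · rw [val_finRotate, if_neg (by simpa [counter_eq, hs₂.numVertices] using hle)]
    simp
  have vertex_eq {e : NExp} {i : Fin G.n} (he : e.eval s₃ = i) :
      (candidateVertex e).eval s₃ = τ i := by
    rw [← hτ, ← he, NExp.eval_read, hf₃.nat Reg.order, hf₂.nat Reg.order, hf₁.nat Reg.order,
      NExp.eval_read, hf₃.nat Reg.candidate, hf₂.nat Reg.candidate, hf₁.nat Reg.candidate]
    rfl
  have source_eq := vertex_eq (e := .var Reg.counter) (i := k)
    (by simp [hf₃.nat Reg.counter, counter_eq])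
  have target_eq := vertex_eq (e := .var Reg.next) (i := finRotate G.n k) next_eq
  rw [Finset.sum_range_succ, ← length_eq₂, Fin.ofNat_val_eq_self]
  simp only [RExp.eval_add, RExp.eval_read, source_eq, target_eq, (hs₂.frame hf₃).dist,
    hf₃.real RealReg.length, State.setReal_real]
  rfl

/-- The best of the first `k` candidates `τ c`, and its length, are in the memory. -/
def State.HoldsBest (s : State) (τ : Fin K → Equiv.Perm (Fin G.n)) (k : ℕ) : Prop :=
  0 < k → ∃ c : Fin K, s.nat Reg.best 0 0 = c ∧
    s.real RealReg.minLength 0 0 = G.tourLength (τ c) ∧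
    ∀ c' : Fin K, c' < k → G.tourLength (τ c) ≤ G.tourLength (τ c')

/-- Replaces the best tour by the current candidate if that is the first one or shorter. -/
def compareProg : Program :=
  .ite (.and (.natLe 1 (.var Reg.candidate))
      (.realLe (.var RealReg.minLength) (.var RealReg.length))) .skip
    (.setVar Reg.best (.var Reg.candidate) ;;
      .setRealVar RealReg.minLength (.var RealReg.length))

theorem haltsWithin_compareProg {k : Fin K} (hk : s.nat Reg.candidate 0 0 = k)
    (hlength : s.real RealReg.length 0 0 = G.tourLength (τ k)) (hbest : s.HoldsBest τ k) :
    compareProg.HaltsWithin s 3 fun s' => s'.HoldsBest τ (k + 1) := by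
  refine (ite (B := 1 + 1) (fun hskip => (skip fun _ => ?_).mono (by norm_num)
    fun _ _ h => h) fun hlt => setVar_seq fun s₁ hf₁ best_eq => setReal fun _ => ?_).mono
    (by norm_num) fun _ _ h => h
  · obtain ⟨hpos, hle⟩ := hskip
    obtain ⟨c, best_eq, min_eq, min_le⟩ := hbest (by simpa [hk, Nat.succ_le_iff] using hpos)
    refine ⟨c, best_eq, min_eq, fun c' hc' => ?_⟩
    rcases Nat.lt_succ_iff_lt_or_eq.1 hc' with hc' | hc'
    · exact min_le c' hc'
    · rw [Fin.ext hc']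
      simpa [min_eq, hlength] using hle
  · refine ⟨k, by simpa [hk] using best_eq, by simp [hf₁.real RealReg.length, hlength],
      fun c' hc' => ?_⟩
    rcases Nat.lt_succ_iff_lt_or_eq.1 hc' with hc' | hc'
    · obtain ⟨c, -, min_eq, min_le⟩ := hbest (by omega)
      have length_lt : G.tourLength (τ k) < G.tourLength (τ c) := by
        simpa [hk, min_eq, hlength, Nat.succ_le_iff, (Nat.zero_le _).trans_lt hc'] using hlt
      exact length_lt.le.trans (min_le c' hc')
    · rw [Fin.ext hc']

/-- Finds a shortest candidate tour. -/
def selectProg : Program :=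
  .forLoop Reg.candidate (.var Reg.copy) (lengthProg ;; compareProg)

theorem haltsWithin_selectProg (hs : s.HoldsATSP G ε) (hcopy : s.nat Reg.copy 0 0 = K)
    (hτ : ∀ c i, s.nat Reg.order (c : Fin K) (i : Fin G.n) = τ c i) :
    selectProg.HaltsWithin s (K * (5 * G.n + 8) + 2) fun s' => s'.HoldsBest τ K := by
  refine (forLoop (B := 5 * G.n + 3 + 3) K (fun k s' => s'.HoldsBest τ k) (by decide) ?_ ?_ ?_
    fun c s₁ hf₁ hc best => ?_).mono (by linarith) fun _ _ h => h
  · intro s' hf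
    simp [hf.nat Reg.copy, hcopy]
  · exact fun _ _ _ h => h
  · exact fun h => absurd h (lt_irrefl 0)
  refine seq (haltsWithin_lengthProg (hs.frame hf₁) (τ := τ c) ?_) fun s₂ hf₂ length_eq =>
    haltsWithin_compareProg ?_ length_eq ?_
  · simpa [hf₁.nat Reg.order, hc] using hτ c
  · rw [hf₂.nat Reg.candidate, hc]
  · rwa [State.HoldsBest, hf₂.nat Reg.best, hf₂.real RealReg.minLength]

/-- Copies the best tour to the output array. -/
def outputProg : Program :=
  .forLoop Reg.counter (.var Reg.numVertices)
    (.setNat Reg.tour (.var Reg.counter) 0 (.read Reg.order (.var Reg.best) (.var Reg.counter)))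

theorem haltsWithin_outputProg {n : ℕ} {τ : Equiv.Perm (Fin n)}
    (hn : s.nat Reg.numVertices 0 0 = n)
    (hτ : ∀ i : Fin n, s.nat Reg.order (s.nat Reg.best 0 0) i = τ i) :
    outputProg.HaltsWithin s (3 * n + 2) fun s' => s'.HoldsTour τ := by
  refine (forLoop (B := 1) n (fun k s' => ∀ i : Fin n, i < k → s'.nat Reg.tour i 0 = τ i)
    (by decide) ?_ ?_ (by simp) fun k s' hf counter_eq tour_eq => setNat fun i hi => ?_).mono
    (by linarith) fun s' _ h i => h i i.2
  · intro s' hf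
    simp [hf.nat Reg.numVertices, hn]
  · exact fun _ _ _ h => h
  · rcases Nat.lt_succ_iff_lt_or_eq.1 hi with hi | hi
    · simp [counter_eq, hi.ne, tour_eq i hi]
    · simp [counter_eq, Fin.ext hi, hf.nat Reg.order, hf.nat Reg.best, hτ]

end Select

/-! ### The algorithms -/

section Recover

variable {G : ATSP} {ε : ℝ} {s : State} {σ : Equiv.Perm (Fin (G.toNWFS ε).jobs)}

/-- Reads off a tour from a schedule of the constructed instance. -/
def extractProg : Program := splitProg ;; selectProg ;; outputProg

theorem extract_time_le {n P : ℝ} (hnP : n ≤ P) (hP : 1 ≤ P) :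
    P * P * n * 4 + 2 + (P * P * (5 * n + 8) + 2 + (3 * n + 2)) ≤ 26 * P ^ 5 := by
  calc _ ≤ P * P * P * 4 + 2 + (P * P * (5 * P + 8) + 2 + (3 * P + 2)) := by gcongr
    _ = 9 * P ^ 3 + 8 * P ^ 2 + 3 * P ^ 1 + 6 * P ^ 0 := by ring
    _ ≤ 9 * P ^ 5 + 8 * P ^ 5 + 3 * P ^ 5 + 6 * P ^ 5 := by gcongr <;> norm_num
    _ = 26 * P ^ 5 := by ring

theorem haltsWithin_extractProg (hε : 0 < ε) (hs : s.HoldsReduction G ε)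
    (hσ : s.HoldsSchedule σ) :
    extractProg.HaltsWithin s (26 * (G.scale ε : ℝ) ^ 5) fun s' =>
      ∃ τ : Equiv.Perm (Fin G.n), s'.HoldsTour τ ∧ ∀ α : ℝ, 0 ≤ α → (G.toNWFS ε).IsApprox α σ →
        G.tourLength τ ≤ α * (1 + ε) * G.opt := by
  refine (seq (haltsWithin_splitProg hσ hs.job hs.labels hs.filled) fun s₁ hf₁ order_eq =>
    seq (haltsWithin_selectProg (hs.atsp.frame hf₁) ?_ order_eq) fun s₂ hf₂ best =>
      (?_ : outputProg.HaltsWithin s₂ (3 * G.n + 2) _)).mono ?_ fun _ _ h => h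
  · rw [hf₁.nat Reg.copy, hs.copy]
  · obtain ⟨c, best_eq, -, length_le⟩ := best (Nat.pos_of_neZero _)
    refine (haltsWithin_outputProg ((hs.atsp.frame hf₁).frame hf₂).numVertices
      (τ := copyTour σ c) ?_).mono le_rfl fun s' _ tour => ⟨_, tour, fun α hα hσα =>
        G.tourLength_copyTour_le hε hα hσα fun c' => length_le c' c'.2⟩
    simpa [best_eq, hf₂.nat Reg.order] using order_eq c
  · push_cast
    exact extract_time_le (Nat.cast_le.2 G.n_le_scale) (Nat.one_le_cast.2 (Nat.pos_of_neZero _))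

/-- The second algorithm of the theorem. It repeats the construction, since it is given only
`G`, `ε` and the schedule. -/
def recoverProg : Program := buildProg ;; extractProg

theorem haltsWithin_recoverProg (hε : 0 < ε) (hs : s.HoldsATSP G ε)
    (hzero : ∀ x ∈ [Reg.numJobs, Reg.numMachines, Reg.time, Reg.filled], s.nat x = 0)
    (hσ : s.HoldsSchedule σ) :
    recoverProg.HaltsWithin s (129 * (G.scale ε : ℝ) ^ 5) fun s' =>
      ∃ τ : Equiv.Perm (Fin G.n), s'.HoldsTour τ ∧ ∀ α : ℝ, 0 ≤ α → (G.toNWFS ε).IsApprox α σ →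
        G.tourLength τ ≤ α * (1 + ε) * G.opt := by
  refine (seq (haltsWithin_buildProg hε hs hzero) fun s' hf' ⟨hs', _⟩ =>
    haltsWithin_extractProg hε hs' ?_).mono (by linarith) fun _ _ h => h
  rwa [State.HoldsSchedule, hf'.nat Reg.schedule]

end Recover

theorem Program.HaltsWithin.exists_and {ι : Type*} {p : Program} {s : State} {B : ℝ}
    {Q : ι → State → Prop} {R : ι → Prop}
    (h : p.HaltsWithin s B fun s' => ∃ i, Q i s' ∧ R i) : ∃ i, p.HaltsWithin s B (Q i) ∧ R i := by
  obtain ⟨s', T, e, hT, i, hQ, hR⟩ := h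
  exact ⟨i, ⟨s', T, e, hT, hQ⟩, hR⟩

namespace ATSP

variable (G : ATSP) {ε : ℝ}

theorem input_nat_eq_zero {x : ℕ} (hx : x ≠ Reg.numVertices) : (G.input ε).nat x = 0 := by
  ext i j
  simp [input, hx]

theorem input_nat_eq_zero_of_mem :
    ∀ x ∈ [Reg.numJobs, Reg.numMachines, Reg.time, Reg.filled], (G.input ε).nat x = 0 :=
  fun _ hx => G.input_nat_eq_zero (by rintro rfl; simp at hx)

theorem input_real_eq_zero {x : ℕ} (hd : x ≠ RealReg.dist) (he : x ≠ RealReg.eps) :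
    (G.input ε).real x = 0 := by
  ext i j
  simp [input, hd, he]

theorem holdsATSP_input : (G.input ε).HoldsATSP G ε where
  numVertices := by simp [input]
  dist u v := by simp [input]
  eps := by simp [input]

variable {N : ℕ} (σ : Equiv.Perm (Fin N))

theorem inputWithSchedule_nat_of_ne {x : ℕ} (hx : x ≠ Reg.schedule) :
    (G.inputWithSchedule ε σ).nat x = (G.input ε).nat x := by
  ext i j
  simp [inputWithSchedule, hx]

theorem inputWithSchedule_nat_eq_zero :
    ∀ x ∈ [Reg.numJobs, Reg.numMachines, Reg.time, Reg.filled],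
      (G.inputWithSchedule ε σ).nat x = 0 :=
  fun x hx => (G.inputWithSchedule_nat_of_ne σ (by rintro rfl; simp at hx)).trans
    (G.input_nat_eq_zero_of_mem x hx)

theorem holdsATSP_inputWithSchedule : (G.inputWithSchedule ε σ).HoldsATSP G ε where
  numVertices := by
    rw [G.inputWithSchedule_nat_of_ne σ (by decide), G.holdsATSP_input.numVertices]
  dist := G.holdsATSP_input.dist
  eps := G.holdsATSP_input.eps

theorem holdsSchedule_inputWithSchedule : (G.inputWithSchedule ε σ).HoldsSchedule σ := by
  simp [State.HoldsSchedule, inputWithSchedule]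

theorem scale_le (hε : 0 < ε) : (G.scale ε : ℝ) ≤ 9 * ((G.n : ℝ) + 1 / ε + 1) ^ 2 := by
  have floor_le : (⌊9 / ε⌋₊ : ℝ) ≤ 9 * (1 / ε) :=
    (Nat.floor_le (by positivity)).trans (by ring_nf; rfl)
  have inv_pos : 0 < 1 / ε := by positivity
  calc (G.scale ε : ℝ) = G.n * (⌊9 / ε⌋₊ + 1) := by simp [scale]
    _ ≤ (G.n + 1 / ε + 1) * (9 * (G.n + 1 / ε + 1)) := by gcongr <;> linarith
    _ = 9 * (G.n + 1 / ε + 1) ^ 2 := by ring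

theorem le_polyBound (hε : 0 < ε) {T : ℝ} {c k : ℕ} (hT : T ≤ c * (G.scale ε : ℝ) ^ k) :
    T ≤ polyBound (c * 9 ^ k) (2 * k) G.n ε := by
  calc T ≤ c * (G.scale ε : ℝ) ^ k := hT
    _ ≤ c * (9 * (G.n + 1 / ε + 1) ^ 2) ^ k := by gcongr; exact G.scale_le hε
    _ = polyBound (c * 9 ^ k) (2 * k) G.n ε := by
      rw [polyBound, mul_pow, ← pow_mul]; push_cast; ring

theorem size_toNWFS_le : ((G.toNWFS ε).size : ℝ) ≤ 18 * (G.scale ε : ℝ) ^ 5 := by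
  have n_le := G.n_le_scale (ε := ε)
  rw [← Nat.cast_ofNat, ← Nat.cast_pow, ← Nat.cast_mul, Nat.cast_le]
  set P := G.scale ε
  calc (G.toNWFS ε).size
      ≤ P * P * G.n * ((G.n + 2 * P) * (2 * P)) * 3 :=
        size_copies_le (G.isRootedSemimetric_weight ε)
    _ ≤ P * P * P * ((P + 2 * P) * (2 * P)) * 3 := by gcongr
    _ = 18 * P ^ 5 := by ring

end ATSP

theorem State.holdsInstance_of_nat_eq_input {I : NWFS} {s : State}
    (h : ∀ x ∈ [Reg.numJobs, Reg.numMachines, Reg.time], s.nat x = I.input.nat x) :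
    s.HoldsInstance I := by
  simp only [List.forall_mem_cons] at h
  obtain ⟨jobs_eq, machines_eq, time_eq, -⟩ := h
  simp [HoldsInstance, jobs_eq, machines_eq, time_eq, NWFS.input]

/-! ### A flowshop program as a subroutine -/

section Subroutine

/-- The natural-number arrays through which a subroutine receives its input and returns its
output. -/
abbrev Reg.shared : List ℕ := [Reg.numJobs, Reg.numMachines, Reg.time, Reg.schedule]

theorem Reg.lt_fresh_of_mem_shared : ∀ x ∈ Reg.shared, x < Reg.fresh := by decide

/-- The array that a subroutine uses in place of the natural-number array `x`: the arrays
in `Reg.shared` are common to the subroutine and its caller, the others are fresh. -/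
def subroutineReg (x : ℕ) : ℕ :=
  if x ∈ Reg.shared then x else x + Reg.fresh

/-- The array that a subroutine uses in place of the real array `x`. -/
def subroutineRealReg (x : ℕ) : ℕ := x + RealReg.fresh

theorem subroutineReg_injective : subroutineReg.Injective := by
  intro x y h
  unfold subroutineReg at h
  split_ifs at h with hx hy hy
  · exact h
  · exact absurd (Reg.lt_fresh_of_mem_shared x hx) (by omega)
  · exact absurd (Reg.lt_fresh_of_mem_shared y hy) (by omega)
  · exact Nat.add_right_cancel h

theorem subroutineRealReg_injective : subroutineRealReg.Injective :=
  add_left_injective RealReg.fresh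

theorem notMem_natTargets_rename {x : ℕ} (hx : x < Reg.fresh)
    (hx' : x ∉ Reg.shared) (A : Program) :
    x ∉ (A.rename subroutineReg subroutineRealReg).natTargets := by
  rw [Program.natTargets_rename, List.mem_map]
  rintro ⟨y, -, rfl⟩
  by_cases hy : y ∈ Reg.shared
  · exact hx' (by rwa [subroutineReg, if_pos hy])
  · rw [subroutineReg, if_neg hy] at hx
    exact (Nat.le_add_left _ _).not_gt hx

theorem notMem_realTargets_rename {x : ℕ} (hx : x < RealReg.fresh) (A : Program) :
    x ∉ (A.rename subroutineReg subroutineRealReg).realTargets := by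
  rw [Program.realTargets_rename, List.mem_map]
  rintro ⟨y, -, rfl⟩
  exact absurd hx (Nat.le_add_left _ _).not_gt

theorem notMem_natTargets_buildProg {x : ℕ} (hx : Reg.fresh ≤ x) : x ∉ buildProg.natTargets :=
  fun h => ((by decide : ∀ y ∈ buildProg.natTargets, y < Reg.fresh) x h).not_ge hx

theorem notMem_realTargets_buildProg {x : ℕ} (hx : RealReg.fresh ≤ x) :
    x ∉ buildProg.realTargets :=
  fun h => ((by decide : ∀ y ∈ buildProg.realTargets, y < RealReg.fresh) x h).not_ge hx

variable {G : ATSP} {ε : ℝ} {s : State}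

theorem NWFS.input_nat_eq_zero (I : NWFS) {x : ℕ}
    (hx : x ∉ [Reg.numJobs, Reg.numMachines, Reg.time]) : I.input.nat x = 0 := by
  ext i j
  simp only [List.mem_cons, List.not_mem_nil, or_false, not_or] at hx
  simp [NWFS.input, hx]

theorem pull_eq_input (hf : Frame buildProg (G.input ε) s)
    (h : ∀ x ∈ [Reg.numJobs, Reg.numMachines, Reg.time], s.nat x = (G.toNWFS ε).input.nat x) :
    s.pull subroutineReg subroutineRealReg = (G.toNWFS ε).input := by
  refine congrArg₂ State.mk (funext fun x => ?_) (funext fun x => ?_)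
  · change s.nat (subroutineReg x) = (G.toNWFS ε).input.nat x
    by_cases hx : x ∈ [Reg.numJobs, Reg.numMachines, Reg.time]
    · rw [subroutineReg, if_pos ((by decide : _ ⊆ Reg.shared) hx), h x hx]
    rw [NWFS.input_nat_eq_zero _ hx]
    by_cases hx' : x ∈ Reg.shared
    · obtain rfl : x = Reg.schedule := by simp at hx hx'; omega
      rw [subroutineReg, if_pos hx', hf.nat _ (by decide), G.input_nat_eq_zero (by decide)]
    · have fresh_le : Reg.fresh ≤ x + Reg.fresh := Nat.le_add_left _ _
      rw [subroutineReg, if_neg hx', hf.nat _ (notMem_natTargets_buildProg fresh_le),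
        G.input_nat_eq_zero (((by decide : Reg.numVertices < Reg.fresh).trans_le fresh_le).ne')]
  · have fresh_le : RealReg.fresh ≤ x + RealReg.fresh := Nat.le_add_left _ _
    change s.real (x + RealReg.fresh) = 0
    rw [hf.real _ (notMem_realTargets_buildProg fresh_le),
      G.input_real_eq_zero (((by decide : RealReg.dist < RealReg.fresh).trans_le fresh_le).ne')
        (((by decide : RealReg.eps < RealReg.fresh).trans_le fresh_le).ne')]

theorem State.HoldsReduction.frame_rename {A : Program} {s' : State} (h : s.HoldsReduction G ε)
    (hf : Frame (A.rename subroutineReg subroutineRealReg) s s') : s'.HoldsReduction G ε :=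
  h.frame hf
    (fun x hx => notMem_natTargets_rename
      ((by decide : ∀ x ∈ [Reg.numVertices, Reg.job, Reg.copy, Reg.jobCopy, Reg.jobVertex,
        Reg.filled], x < Reg.fresh) x hx)
      ((by decide : ∀ x ∈ [Reg.numVertices, Reg.job, Reg.copy, Reg.jobCopy, Reg.jobVertex,
        Reg.filled], x ∉ Reg.shared) x hx) A)
    fun x hx => notMem_realTargets_rename
      ((by decide : ∀ x ∈ [RealReg.dist, RealReg.eps], x < RealReg.fresh) x hx) A

/-- The algorithm of the second part, with the flowshop algorithm `A` as a subroutine. -/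
def schemeProg (A : Program) : Program :=
  buildProg ;; A.rename subroutineReg subroutineRealReg ;; extractProg

theorem scheme_time_le {P S : ℝ} (hP : 1 ≤ P) (hS : 0 ≤ S) (hSP : S ≤ 18 * P ^ 5) (c k : ℕ) :
    103 * P ^ 5 + (c * S ^ k + 26 * P ^ 5) ≤ (129 + c * 18 ^ k : ℕ) * P ^ (5 + 5 * k) := by
  calc 103 * P ^ 5 + (c * S ^ k + 26 * P ^ 5)
      ≤ 103 * P ^ 5 + (c * (18 * P ^ 5) ^ k + 26 * P ^ 5) := by gcongr
    _ = 129 * P ^ 5 + c * 18 ^ k * P ^ (5 * k) := by rw [mul_pow, ← pow_mul]; ring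
    _ ≤ 129 * P ^ (5 + 5 * k) + c * 18 ^ k * P ^ (5 + 5 * k) := by
      gcongr <;> first | exact hP | omega
    _ = (129 + c * 18 ^ k : ℕ) * P ^ (5 + 5 * k) := by push_cast; ring

theorem isApproxSchemeATSP_schemeProg {α : ℝ} (hα : 0 ≤ α) {A : Program}
    (hA : IsApproxAlgNWFS α A) : IsApproxSchemeATSP α (schemeProg A) := by
  obtain ⟨c, k, hA⟩ := hA
  refine ⟨_, _, fun G ε hε => (seq (haltsWithin_buildProg hε G.holdsATSP_input
    G.input_nat_eq_zero_of_mem) fun s₁ hf₁ ⟨reduction, input_eq⟩ =>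
    seq (Program.HaltsWithin.rename subroutineReg_injective subroutineRealReg_injective
      (pull_eq_input hf₁ input_eq ▸ hA (G.toNWFS ε)))
    fun s₂ hf₂ ⟨σ, schedule, approx⟩ => ?_).mono (G.le_polyBound hε (scheme_time_le
      (Nat.one_le_cast.2 (Nat.pos_of_neZero _)) (Nat.cast_nonneg _) G.size_toNWFS_le c k))
    fun _ _ h => h⟩
  exact (haltsWithin_extractProg hε (reduction.frame_rename hf₂) schedule).mono le_rfl
    fun s' _ ⟨τ, tour, length_le⟩ => ⟨τ, tour, length_le α hα approx⟩

end Subroutine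


end FlowshopATSP

theorem mainTheorem1 :
    (∃ (build recover : FlowshopATSP.Program) (C : ℝ) (c k : ℕ),
      ∀ (G : FlowshopATSP.ATSP) (ε : ℝ), 0 < ε →
        ∃ I : FlowshopATSP.NWFS,
          (I.size : ℝ) ≤ FlowshopATSP.polyBound c k G.n ε ∧
          build.HaltsWithin (G.input ε) (FlowshopATSP.polyBound c k G.n ε)
            (fun s => s.HoldsInstance I) ∧
          ∀ σ : Equiv.Perm (Fin I.jobs), ∃ τ : Equiv.Perm (Fin G.n),
            recover.HaltsWithin (G.inputWithSchedule ε σ) (FlowshopATSP.polyBound c k G.n ε)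
              (fun s => s.HoldsTour τ) ∧
            ∀ α : ℝ, 1 ≤ α → I.IsApprox α σ →
              G.tourLength τ ≤ α * (1 + C * ε) * G.opt) ∧
    (∀ α : ℝ, 1 ≤ α →
      (∃ A : FlowshopATSP.Program, FlowshopATSP.IsApproxAlgNWFS α A) →
        ∃ B : FlowshopATSP.Program, FlowshopATSP.IsApproxSchemeATSP α B) := by
  refine ⟨⟨FlowshopATSP.buildProg, FlowshopATSP.recoverProg, 1, 129 * 9 ^ 5, 2 * 5,
    fun G ε hε => ⟨G.toNWFS ε, ?_, ?_, fun σ => ?_⟩⟩, fun α hα ⟨A, hA⟩ =>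
      ⟨_, FlowshopATSP.isApproxSchemeATSP_schemeProg (zero_le_one.trans hα) hA⟩⟩
  all_goals have scale_pow_nonneg : 0 ≤ (G.scale ε : ℝ) ^ 5 := by positivity
  · exact G.le_polyBound hε (G.size_toNWFS_le.trans (by push_cast; linarith))
  · exact (FlowshopATSP.haltsWithin_buildProg hε G.holdsATSP_input G.input_nat_eq_zero_of_mem).mono
      (G.le_polyBound hε (by push_cast; linarith))
      fun s _ ⟨_, input_eq⟩ => FlowshopATSP.State.holdsInstance_of_nat_eq_input input_eq
  · obtain ⟨τ, halts, length_le⟩ := (FlowshopATSP.haltsWithin_recoverProg hε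
      (G.holdsATSP_inputWithSchedule σ) (G.inputWithSchedule_nat_eq_zero σ)
      (G.holdsSchedule_inputWithSchedule σ)).exists_and
    refine ⟨τ, halts.mono (G.le_polyBound hε (by push_cast; rfl)) fun _ _ h => h, fun α hα hσ => ?_⟩
    rw [one_mul]
    exact length_le α (zero_le_one.trans hα) hσ
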